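/- Let $\Gamma$ be a tree (a connected graph without cycles, every vertex having finite degree) with root $o$, and assume that the number of children of the vertices is bounded. Write $x\le y$ if $x$ lies on the shortest path from $o$ to $y$, and let $\Gamma(v)$ be the subtree of $\Gamma$ consisting of the vertices $w\ge v$. Let $\mathbf S$ be the unit circle (angles modulo $2\pi$) with normalized Lebesgue measure $d\mathbf x$, let $H(\theta,\phi)=-\cos(\theta-\phi)$, and let $\mathcal J:E(\Gamma)\to[0,\infty)$ be arbitrary interaction strengths. A *cutset* is a finite set $C$ of vertices not containing $o$ which meets every infinite self-avoiding path from $o$ and contains no pair $x<y$. Let $C^i$ be the component of $\Gamma\setminus C$ containing $o$, and $C^o$ the union of the infinite components of $\Gamma\setminus C$. For $\delta\in\mathbf S^C$, let $\mu_C^{\delta}$ be the probability measure on $\mathbf S^{C^i}$ whose density with respect to the product measure $d\mathbf x^{C^i}$ is proportional to $$\eta\mapsto\exp\Big(-\sum_{\overline{xy}\in E(\Gamma),\ x,y\in C^i}\mathcal J(\overline{xy})\,H(\eta(x),\eta(y))-\sum_{\overline{xy}\in E(\Gamma),\ x\in C^i,\ y\in C}\mathcal J(\overline{xy})\,H(\eta(x),\delta(y))\Big).$$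 For $v\in C^i$, let $f_{C,v}^{\delta}$ be the density with respect to $d\mathbf x$ of the marginal at $v$ of the measure defined in the same way on the tree $\Gamma(v)$ rooted at $v$, with the cutset $C\cap\Gamma(v)$ and the restrictions of $\mathcal J$ and $\delta$. Fix $\hat 0\in\mathbf S$ and write $f_{C,v}^{+}$ for $f_{C,v}^{\delta}$ with $\delta\equiv\hat 0$. A sequence of cutsets $C_n$ *approaches infinity* if every vertex belongs to $C_n^i$ for all sufficiently large $n$. A *Gibbs state* is a probability measure on $\mathbf S^{V(\Gamma)}$ such that, for every cutset $C$, the conditional distribution of the configuration on $C^i$ given the configuration $\delta'$ on $C\cup C^o$ is $\mu_C^{\delta}$, where $\delta$ is the restriction of $\delta'$ to $C$. - **SB** (symmetry breaking): there is a Gibbs state whose marginal distribution at some vertex is not rotation invariant. - **SB+** (symmetry breaking with plus boundary conditions): there are a vertex $v$ and a sequence of cutsets $C_n$ approaching infinity, with $v\in C_n^i$ for every $n$, such that $\inf_n\|f_{C_n,v}^{+}-1\|_\infty\neq 0$. Then, for every $\hat 0\in\mathbf S$, SB holds if and only if SB+ holds. -/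

import Mathlib

open MeasureTheory Filter
open scoped NNReal ENNReal

namespace Rotor

/-- The spin space: the unit circle, parametrised by the angle modulo `2π`. It acts on itself by
translations. -/
abbrev Spin : Type := AddCircle (2 * Real.pi)

instance instFactTwoPiPos : Fact (0 < 2 * Real.pi) := ⟨Real.two_pi_pos⟩

/-- Normalized Lebesgue measure on the circle. -/
noncomputable abbrev unif : Measure Spin := AddCircle.haarAddCircle

/-- The rotor energy function `H(θ, φ) = - cos (θ - φ)`. -/
noncomputable def energy (θ φ : Spin) : ℝ := - Real.cos_periodic.lift (θ - φ)

theorem energy_symm (θ φ : Spin) : energy θ φ = energy φ θ := by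
  induction θ using QuotientAddGroup.induction_on with | H x => ?_
  induction φ using QuotientAddGroup.induction_on with | H y => ?_
  change - Real.cos (x - y) = - Real.cos (y - x)
  rw [← Real.cos_neg, neg_sub]

variable {V : Type*}

/-- The energy `H(ξ x, ξ y)` of a configuration along the unordered pair `{x, y}`. -/
noncomputable def pairEnergy (ξ : V → Spin) : Sym2 V → ℝ :=
  Sym2.lift ⟨fun x y => energy (ξ x) (ξ y), fun _ _ => energy_symm _ _⟩

/-- `x ≤ y` in the tree rooted at `o`: the vertex `x` lies on the shortest path from `o` to `y`. -/
def Le (G : SimpleGraph V) (o x y : V) : Prop := G.dist o x + G.dist x y = G.dist o y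

/-- The children of `x`: the vertices `y` with `x ≤ y` and `|y| = |x| + 1`. -/
def children (G : SimpleGraph V) (o x : V) : Set V :=
  {y | Le G o x y ∧ G.dist o y = G.dist o x + 1}

/-- A cutset: a finite set of vertices not including the root, which meets every infinite
self-avoiding path from the root and contains no pair `x < y`. -/
structure IsCutset (G : SimpleGraph V) (o : V) (C : Finset V) : Prop where
  root_notMem : o ∉ C
  meets : ∀ p : ℕ → V, p 0 = o → Function.Injective p → (∀ n, G.Adj (p n) (p (n + 1))) →
    ∃ n, p n ∈ C
  antichain : ∀ x ∈ C, ∀ y ∈ C, Le G o x y → x = y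

/-- The connected component of the vertex `v` in `Γ \ C` (empty if `v ∈ C`). -/
def component (G : SimpleGraph V) (C : Finset V) (v : V) : Set V :=
  {w | ∃ p : G.Walk v w, ∀ x ∈ p.support, x ∉ C}

/-- The inside `C^i`: the component of `Γ \ C` that contains the root. -/
def inside (G : SimpleGraph V) (o : V) (C : Finset V) : Set V := component G C o

/-- The outside `C^o`: the union of the infinite components of `Γ \ C`. -/
def outside (G : SimpleGraph V) (C : Finset V) : Set V := {v | (component G C v).Infinite}

/-- A sequence of cutsets approaching infinity. -/
def ApproachesInfinity (G : SimpleGraph V) (o : V) (C : ℕ → Finset V) : Prop :=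
  (∀ n, IsCutset G o (C n)) ∧ ∀ v, ∀ᶠ n in atTop, v ∈ inside G o (C n)

open Classical in
/-- The configuration equal to `η` on `Λ` and to `δ` off `Λ`. -/
noncomputable def glue (Λ : Set V) (η : Λ → Spin) (δ : V → Spin) (v : V) : Spin :=
  if h : v ∈ Λ then η ⟨v, h⟩ else δ v

/-- The Hamiltonian on the region `Λ` with boundary condition `δ` on `D` (disjoint from `Λ`): the
sum of the interactions along the edges inside `Λ` and along the edges between `Λ` and `D`.
Only the values of `δ` on `D` enter. -/
noncomputable def hamiltonian (G : SimpleGraph V) (J : G.edgeSet → ℝ≥0) (Λ D : Set V)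
    (δ : V → Spin) (η : Λ → Spin) : ℝ :=
  (∑ᶠ (e : G.edgeSet) (_ : ∀ x ∈ (e : Sym2 V), x ∈ Λ),
      (J e : ℝ) * pairEnergy (glue Λ η δ) e) +
    ∑ᶠ (e : G.edgeSet) (_ : ∃ x ∈ Λ, ∃ y ∈ D, (e : Sym2 V) = s(x, y)),
      (J e : ℝ) * pairEnergy (glue Λ η δ) e

/-- The Gibbs measure on `Λ` with boundary condition `δ` on `D`: the probability measure on
`Spin ^ Λ` with density `exp (- H) / Z` with respect to the product of the uniform measures. -/
noncomputable def gibbs (G : SimpleGraph V) (J : G.edgeSet → ℝ≥0) (Λ D : Set V)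
    (δ : V → Spin) : Measure (Λ → Spin) :=
  (Measure.infinitePi fun _ : Λ => unif).tilted fun η => - hamiltonian G J Λ D δ η

/-- The measure `μ_C^δ` on `Spin ^ (C^i)`. -/
noncomputable def gibbsCutset (G : SimpleGraph V) (o : V) (J : G.edgeSet → ℝ≥0) (C : Finset V)
    (δ : V → Spin) : Measure (inside G o C → Spin) :=
  gibbs G J (inside G o C) C δ

/-- `μ` is a Gibbs state: a probability measure on `Spin ^ V` such that, for every cutset `C`, the
conditional distribution of the configuration on `C^i` given the configuration `δ'` on `C ∪ C^o` is
`μ_C^δ`, with `δ` the restriction of `δ'` to `C`. -/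
def IsGibbsState (G : SimpleGraph V) (o : V) (J : G.edgeSet → ℝ≥0) (μ : Measure (V → Spin)) :
    Prop :=
  IsProbabilityMeasure μ ∧
    ∀ C : Finset V, IsCutset G o C → ∀ A : Set (inside G o C → Spin), MeasurableSet A →
      μ[((inside G o C).domRestrict ⁻¹' A).indicator (fun _ => (1 : ℝ)) |
          MeasurableSpace.comap (C ∪ outside G C : Set V).domRestrict inferInstance]
        =ᵐ[μ] fun ξ => (gibbsCutset G o J C ξ).real A

/-- Symmetry breaking (SB): there is a Gibbs state whose marginal at some vertex is not invariant
under the action of the circle on itself. -/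
def SB (G : SimpleGraph V) (o : V) (J : G.edgeSet → ℝ≥0) : Prop :=
  ∃ μ : Measure (V → Spin), IsGibbsState G o J μ ∧
    ∃ v : V, ¬ (μ.map fun ξ => ξ v).IsAddLeftInvariant

/-- The vertex set of the subtree `Γ(v)` of `v` and its descendants. -/
def subtree (G : SimpleGraph V) (o v : V) : Set V := {w | Le G o v w}

theorem mem_subtree_self (G : SimpleGraph V) (o v : V) : v ∈ subtree G o v := by
  simp [subtree, Le]

/-- For `v ∈ C^i`, the density `f_{C,v}^δ`: the marginal density at `v`, with respect to the uniform
measure, of the Gibbs measure on the subtree `Γ(v)` with boundary condition `δ` on the cutset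
`C ∩ Γ(v)` of `Γ(v)`, whose inside is `C^i ∩ Γ(v)`. -/
noncomputable def density (G : SimpleGraph V) (o : V) (J : G.edgeSet → ℝ≥0) (C : Finset V)
    (δ : V → Spin) (v : V) (hv : v ∈ inside G o C) (θ : Spin) : ℝ :=
  (((gibbs G J (inside G o C ∩ subtree G o v) (C ∩ subtree G o v) δ).map
    fun η => η ⟨v, hv, mem_subtree_self G o v⟩).rnDeriv unif θ).toReal

/-- Symmetry breaking with plus boundary conditions (SB+), where the plus boundary condition is the
constant configuration `zero`: for some vertex `v` and some sequence of cutsets approaching infinity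
(all with `v` inside, so that the densities are defined), the `L^∞` distances of the marginal
densities from `1` have nonzero infimum. -/
def SBPlus (G : SimpleGraph V) (o : V) (J : G.edgeSet → ℝ≥0) (zero : Spin) : Prop :=
  ∃ (v : V) (C : ℕ → Finset V) (hv : ∀ n, v ∈ inside G o (C n)),
    ApproachesInfinity G o C ∧
      ⨅ n, eLpNorm (fun θ => density G o J (C n) (fun _ => zero) v (hv n) θ - 1) ∞ unif ≠ 0

end Rotor

/-! Both implications rest on Ginibre's inequality. For a ferromagnetic rotor system, `E[cos(m ξ(v)
- c)]` under arbitrary boundary spins, with some edges possibly deleted, is at most the plus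
expectation `E⁺[cos(m(ξ(v) - zero))]` for the full edge set (`ginibre_comparison`,
`integral_cosS_le`). As `c` may be shifted by `π`, the plus state maximizes the absolute value of
every Fourier coefficient (`abs_cosExp_le_plusExp`).

SB implies SB+. If SB+ fails, then for each `v` the subtree density at `v` is uniformly close to `1`
for all cutsets whose inside contains a large ball (`eventually_density_of_not_sbPlus`). At the root
the subtree is the whole tree, so the plus coefficients there are small. From a vertex `u` to its
child `v`, integrate over the subtree of `v` first: the spin at `v` is nearly uniform apart from the
kernel `exp(J cos(ξ(v) - ξ(u)))`, and convolution with an even kernel multiplies each character by a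
constant. So smallness at `u` passes to `v` (`plusExp_le_of_parent`), and by induction the plus
coefficients are small at every vertex. They dominate the coefficients of every Gibbs state, so
every one-vertex marginal is uniform.

SB+ implies SB. By compactness the plus states on the given cutsets have an ultrafilter limit, which
is a Gibbs state (`exists_isGibbsState_tendsto`). If its marginal at `v` were invariant, the plus
coefficients at `v` would tend to `0`; by Ginibre so would those of the subtree marginals, which
therefore converge weakly to the uniform measure. Their densities are log-Lipschitz with a constant
depending only on the edges at `v`, so the convergence is uniform (`eventually_abs_sub_one_le`),
contradicting the nonzero infimum. -/

namespace Rotor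

/-! ### The cosine on the circle -/

/-- The cosine as a function on the circle. -/
noncomputable def cosS : Spin → ℝ := Real.cos_periodic.lift

/-- This product formula is what makes a sum over two replicas factorize in Ginibre's argument. -/
theorem cosS_add_add_cosS_sub (a b : Spin) :
    cosS (a + b) + cosS (a - b) = 2 * cosS a * cosS b := by
  induction a using QuotientAddGroup.induction_on with | H x => ?_
  induction b using QuotientAddGroup.induction_on with | H y => ?_
  change Real.cos (x + y) + Real.cos (x - y) = 2 * Real.cos x * Real.cos y
  rw [Real.cos_add, Real.cos_sub]; ring

theorem cosS_neg (a : Spin) : cosS (-a) = cosS a := by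
  induction a using QuotientAddGroup.induction_on with | H x => ?_
  exact Real.cos_neg x

theorem cosS_add_pi (a : Spin) : cosS (a + ((Real.pi : ℝ) : Spin)) = - cosS a := by
  induction a using QuotientAddGroup.induction_on with | H x => ?_
  exact Real.cos_add_pi x

theorem cosS_sub_pi (a : Spin) : cosS (a - ((Real.pi : ℝ) : Spin)) = - cosS a := by
  induction a using QuotientAddGroup.induction_on with | H x => ?_
  exact Real.cos_sub_pi x

theorem abs_cosS_le_one (a : Spin) : |cosS a| ≤ 1 := by
  induction a using QuotientAddGroup.induction_on with | H x => ?_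
  exact Real.abs_cos_le_one x

@[fun_prop]
theorem continuous_cosS : Continuous cosS := continuous_quot_lift _ Real.continuous_cos

/-- The circle norm is attained by some representative of the difference; shifting `y` by that
multiple of `2π` reduces to the sum-to-product formula on the line. -/
theorem abs_cosS_sub_le (a b : Spin) : |cosS a - cosS b| ≤ ‖a - b‖ := by
  induction a using QuotientAddGroup.induction_on with | H x => ?_
  induction b using QuotientAddGroup.induction_on with | H y => ?_
  obtain ⟨n, hn⟩ : ∃ n : ℤ, ‖((x - y : ℝ) : Spin)‖ = |(x - y) - n * (2 * Real.pi)| :=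
    ⟨_, AddCircle.norm_eq _⟩
  change |Real.cos x - Real.cos y| ≤ ‖((x - y : ℝ) : Spin)‖
  rw [hn]
  have h1 : Real.cos y = Real.cos (y + n * (2 * Real.pi)) := (Real.cos_add_int_mul_two_pi y n).symm
  rw [h1, Real.cos_sub_cos, abs_mul, abs_mul]
  have h2 := Real.abs_sin_le_one ((x + (y + n * (2 * Real.pi))) / 2)
  have h3 : |Real.sin ((x - (y + n * (2 * Real.pi))) / 2)| ≤ |(x - (y + n * (2 * Real.pi))) / 2| :=
    Real.abs_sin_le_abs
  have h4 : |(x - (y + n * (2 * Real.pi))) / 2| = |x - y - n * (2 * Real.pi)| / 2 := by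
    rw [abs_div, abs_two]; congr 2; ring
  rw [h4] at h3
  rw [abs_neg, abs_two]
  nlinarith [abs_nonneg (Real.sin ((x - (y + n * (2 * Real.pi))) / 2)),
    abs_nonneg (Real.sin ((x + (y + n * (2 * Real.pi))) / 2))]

/-- Needed twice: to split a phase evenly between two factors, and to make `(x, y) ↦ (x + y, x - y)`
surjective. -/
theorem exists_half (c : Spin) : ∃ s : Spin, s + s = c := by
  induction c using QuotientAddGroup.induction_on with | H x => ?_
  refine ⟨((x / 2 : ℝ) : Spin), ?_⟩
  change ((x / 2 + x / 2 : ℝ) : Spin) = (x : Spin)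
  rw [add_halves]

/-! ### Ginibre's inequality with phases -/

section Ginibre

variable {G : Type*} [AddCommGroup G] [TopologicalSpace G] [IsTopologicalAddGroup G]
  [CompactSpace G] [SecondCountableTopology G] [MeasurableSpace G] [BorelSpace G]

theorem integrable_of_continuous {X : Type*} [TopologicalSpace X] [CompactSpace X]
    [MeasurableSpace X] [OpensMeasurableSpace X] {E : Type*} [NormedAddCommGroup E]
    [SecondCountableTopologyEither X E] {μ : Measure X} [IsFiniteMeasure μ]
    {f : X → E} (hf : Continuous f) : Integrable f μ :=
  hf.integrable_of_hasCompactSupport (HasCompactSupport.of_compactSpace f)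

/-- Splitting off one factor of the power absorbs `q i` into `p`, so the induction runs over all
`p`; at power zero the integral is the square of `∫ p`. -/
theorem integral_pow_kernel_nonneg {X : Type*} [TopologicalSpace X] [CompactSpace X]
    [MeasurableSpace X] [OpensMeasurableSpace X] [SecondCountableTopology X]
    (μ : Measure X) [IsFiniteMeasure μ] {ι : Type*} (s : Finset ι) (a : ι → ℝ)
    (ha : ∀ i ∈ s, 0 ≤ a i) (q : ι → X → ℝ) (hq : ∀ i, Continuous (q i)) (n : ℕ)
    (p : X → ℝ) (hp : Continuous p) :
    0 ≤ ∫ z, (p z.1 * p z.2) * (∑ i ∈ s, a i * (q i z.1 * q i z.2)) ^ n ∂(μ.prod μ) := by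
  induction n generalizing p with
  | zero =>
    simp only [pow_zero, mul_one]
    rw [integral_prod_mul]
    exact mul_self_nonneg _
  | succ n ih =>
    have : ∀ z : X × X, (p z.1 * p z.2) * (∑ i ∈ s, a i * (q i z.1 * q i z.2)) ^ (n + 1)
        = ∑ i ∈ s, a i * (((p z.1 * q i z.1) * (p z.2 * q i z.2)) *
          (∑ i ∈ s, a i * (q i z.1 * q i z.2)) ^ n) := by
      intro z
      rw [pow_succ, Finset.mul_sum, Finset.mul_sum]
      exact Finset.sum_congr rfl fun i _ => by ring
    simp_rw [this]
    rw [integral_finsetSum _ fun i _ => integrable_of_continuous (by fun_prop)]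
    refine Finset.sum_nonneg fun i hi => ?_
    rw [integral_const_mul]
    exact mul_nonneg (ha i hi) (ih (fun x => p x * q i x) (hp.mul (hq i)))

/-- Expand the exponential in its power series; compactness supplies the dominating constant. -/
theorem integral_exp_kernel_nonneg {X : Type*} [TopologicalSpace X] [CompactSpace X]
    [MeasurableSpace X] [OpensMeasurableSpace X] [SecondCountableTopology X]
    (μ : Measure X) [IsFiniteMeasure μ] {ι : Type*} (s : Finset ι) (a : ι → ℝ)
    (ha : ∀ i ∈ s, 0 ≤ a i) (q : ι → X → ℝ) (hq : ∀ i, Continuous (q i))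
    (p : X → ℝ) (hp : Continuous p) :
    0 ≤ ∫ z, (p z.1 * p z.2) * Real.exp (∑ i ∈ s, a i * (q i z.1 * q i z.2)) ∂(μ.prod μ) := by
  set K : X × X → ℝ := fun z => ∑ i ∈ s, a i * (q i z.1 * q i z.2) with hK
  have hKc : Continuous K := by fun_prop
  obtain ⟨M, hM⟩ := isCompact_univ.exists_bound_of_continuousOn hKc.continuousOn
  obtain ⟨N, hN⟩ := isCompact_univ.exists_bound_of_continuousOn
    (f := fun z : X × X => p z.1 * p z.2) (by fun_prop)
  have hlim : Tendsto (fun n => ∫ z, (p z.1 * p z.2) *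
      (∑ k ∈ Finset.range n, K z ^ k / (k.factorial : ℝ)) ∂(μ.prod μ)) atTop
      (nhds (∫ z, (p z.1 * p z.2) * Real.exp (K z) ∂(μ.prod μ))) := by
    refine tendsto_integral_of_dominated_convergence (fun _ => N * Real.exp M) ?_ ?_ ?_ ?_
    · intro n
      exact (integrable_of_continuous (by fun_prop)).aestronglyMeasurable
    · exact integrable_const _
    · intro n
      refine Eventually.of_forall fun z => ?_
      rw [norm_mul]
      have h1 := hN z (Set.mem_univ z)
      refine mul_le_mul h1 ?_ (norm_nonneg _) ((norm_nonneg _).trans h1)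
      refine (norm_sum_le _ _).trans ?_
      refine le_trans (Finset.sum_le_sum fun k _ => ?_)
        (Real.sum_le_exp_of_nonneg ((norm_nonneg _).trans (hM z (Set.mem_univ z))) n)
      rw [norm_div, norm_pow, Real.norm_natCast]
      gcongr
      exact hM z (Set.mem_univ z)
    · refine Eventually.of_forall fun z => ?_
      refine Tendsto.const_mul _ ?_
      have := (NormedSpace.expSeries_div_hasSum_exp (𝔸 := ℝ) (K z)).tendsto_sum_nat
      rwa [← Real.exp_eq_exp_ℝ] at this
  refine ge_of_tendsto' hlim fun n => ?_
  simp_rw [Finset.mul_sum]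
  rw [integral_finsetSum _ fun i _ => integrable_of_continuous (by fun_prop)]
  refine Finset.sum_nonneg fun k _ => ?_
  have := integral_pow_kernel_nonneg μ s a ha q hq k p hp
  simp_rw [← mul_div_assoc]
  rw [integral_div]
  positivity

/-- A continuous surjective endomorphism of a compact group preserves Haar probability. Surjectivity
is where divisibility by two enters. -/
theorem measurePreserving_add_sub (hdiv : ∀ x : G, ∃ y, y + y = x) (μ : Measure G)
    [IsProbabilityMeasure μ] [μ.IsAddHaarMeasure] :
    MeasurePreserving (fun z : G × G => (z.1 + z.2, z.1 - z.2)) (μ.prod μ) (μ.prod μ) := by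
  let T : G × G →+ G × G :=
    { toFun := fun z => (z.1 + z.2, z.1 - z.2)
      map_zero' := by simp
      map_add' := fun x y => by ext <;> simp <;> abel }
  refine AddMonoidHom.measurePreserving (f := T)
    (Continuous.prodMk (continuous_fst.add continuous_snd) (continuous_fst.sub continuous_snd))
    ?_ (by simp)
  rintro ⟨x, y⟩
  obtain ⟨u, hu⟩ := hdiv x
  obtain ⟨w, hw⟩ := hdiv y
  exact ⟨(u + w, u - w), by ext <;> simp [T, ← hu, ← hw]⟩

/-- Ginibre's inequality for two replicas of a rotor system, the second one with arbitrary
phases. -/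
theorem ginibre (hdiv : ∀ x : G, ∃ y, y + y = x) (μ : Measure G)
    [IsProbabilityMeasure μ] [μ.IsAddHaarMeasure] {ι : Type*} (s : Finset ι) (J : ι → ℝ)
    (hJ : ∀ i ∈ s, 0 ≤ J i) (χ : ι → G →+ Spin) (hχ : ∀ i, Continuous (χ i)) (c : ι → Spin)
    (χ₀ : G →+ Spin) (hχ₀ : Continuous χ₀) (c₀ : Spin) :
    0 ≤ ∫ z, (cosS (χ₀ z.1) + cosS (χ₀ z.2 - c₀)) *
      Real.exp (∑ i ∈ s, J i * (cosS (χ i z.1) + cosS (χ i z.2 - c i))) ∂(μ.prod μ) := by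
  choose h hh using exists_half
  -- In rotated variables each two-replica term becomes `q(x) q(-y)` with the same function `q`. The
  -- reflection `hN` below removes the sign and leaves a positive definite kernel.
  have key : ∀ (χ : G →+ Spin) (c : Spin) (x y : G),
      cosS (χ (x + y)) + cosS (χ (x - y) - c) =
        2 * (cosS (χ x - h c) * cosS (χ (-y) - h c)) := by
    intro χ c x y
    have h1 : cosS (χ (-y) - h c) = cosS (χ y + h c) := by
      rw [← cosS_neg, map_neg]; congr 1; abel
    rw [h1, ← mul_assoc, ← cosS_add_add_cosS_sub]
    congr 2
    · rw [map_add]; abel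
    · nth_rewrite 1 [← hh c]; rw [map_sub]; abel
  have hT := measurePreserving_add_sub hdiv μ
  have hN : MeasurePreserving (fun z : G × G => (z.1, -z.2)) (μ.prod μ) (μ.prod μ) :=
    (MeasurePreserving.id μ).prod (Measure.measurePreserving_neg μ)
  have hTN := hT.comp hN
  have := integral_exp_kernel_nonneg μ s (fun i => 2 * J i)
    (fun i hi => mul_nonneg zero_le_two (hJ i hi)) (fun i x => cosS (χ i x - h (c i)))
    (fun i => by have := hχ i; fun_prop) (fun x => cosS (χ₀ x - h c₀)) (by fun_prop)
  rw [← hTN.map_eq, integral_map hTN.measurable.aemeasurable]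
  · simp only [Function.comp_apply, key, neg_neg]
    simp_rw [show ∀ a b : ℝ, 2 * a * b = 2 * (a * b) from fun a b => mul_assoc _ _ _] at this ⊢
    rw [integral_const_mul]
    refine mul_nonneg zero_le_two (this.trans_eq ?_)
    congr! 4 with z
    exact Finset.sum_congr rfl fun i _ => by ring
  · refine Continuous.aestronglyMeasurable ?_
    have := hχ
    fun_prop

/-- Increasing the couplings of a ferromagnetic rotor system and removing its phases increases
the expectation of every cosine. -/
theorem ginibre_comparison (hdiv : ∀ x : G, ∃ y, y + y = x) (μ : Measure G)
    [IsProbabilityMeasure μ] [μ.IsAddHaarMeasure] {ι : Type*} (s : Finset ι) (J J' : ι → ℝ)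
    (hJ' : ∀ i ∈ s, 0 ≤ J' i) (hJ : ∀ i ∈ s, J' i ≤ J i) (χ : ι → G →+ Spin)
    (hχ : ∀ i, Continuous (χ i)) (c : ι → Spin) (χ₀ : G →+ Spin) (hχ₀ : Continuous χ₀)
    (c₀ : Spin) :
    (∫ x, cosS (χ₀ x - c₀) * Real.exp (∑ i ∈ s, J' i * cosS (χ i x - c i)) ∂μ) *
        ∫ x, Real.exp (∑ i ∈ s, J i * cosS (χ i x)) ∂μ ≤
      (∫ x, cosS (χ₀ x) * Real.exp (∑ i ∈ s, J i * cosS (χ i x)) ∂μ) *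
        ∫ x, Real.exp (∑ i ∈ s, J' i * cosS (χ i x - c i)) ∂μ := by
  -- Each term is doubled, with couplings `(J ± J') / 2` and phases `c`, `c + π`. The first replica,
  -- without phases, sees the sum `J`; the second sees the difference `J'`. The extra `π` in the
  -- observable turns the sum of cosines into a difference.
  have h := ginibre hdiv μ (s.disjSum s)
    (Sum.elim (fun i => (J i + J' i) / 2) (fun i => (J i - J' i) / 2))
    (by
      intro i hi
      rcases Finset.mem_disjSum.1 hi with ⟨j, hj, rfl⟩ | ⟨j, hj, rfl⟩
      · have := hJ j hj; have := hJ' j hj; simp only [Sum.elim_inl]; linarith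
      · have := hJ j hj; simp only [Sum.elim_inr]; linarith)
    (Sum.elim χ χ) (by rintro (i | i) <;> exact hχ i)
    (Sum.elim c fun i => c i + ((Real.pi : ℝ) : Spin)) χ₀ hχ₀ (c₀ + ((Real.pi : ℝ) : Spin))
  have e : ∀ z : G × G, (cosS (χ₀ z.1) + cosS (χ₀ z.2 - (c₀ + ((Real.pi : ℝ) : Spin)))) *
      Real.exp (∑ i ∈ s.disjSum s, Sum.elim (fun i => (J i + J' i) / 2)
        (fun i => (J i - J' i) / 2) i * (cosS ((Sum.elim χ χ : ι ⊕ ι → G →+ Spin) i z.1) +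
          cosS ((Sum.elim χ χ : ι ⊕ ι → G →+ Spin) i z.2 -
            (Sum.elim c fun i => c i + ((Real.pi : ℝ) : Spin)) i))) =
      (cosS (χ₀ z.1) * Real.exp (∑ i ∈ s, J i * cosS (χ i z.1))) *
        Real.exp (∑ i ∈ s, J' i * cosS (χ i z.2 - c i)) -
      Real.exp (∑ i ∈ s, J i * cosS (χ i z.1)) *
        (cosS (χ₀ z.2 - c₀) * Real.exp (∑ i ∈ s, J' i * cosS (χ i z.2 - c i))) := by
    intro z
    have e1 : ∑ i ∈ s.disjSum s, Sum.elim (fun i => (J i + J' i) / 2)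
        (fun i => (J i - J' i) / 2) i * (cosS ((Sum.elim χ χ : ι ⊕ ι → G →+ Spin) i z.1) +
          cosS ((Sum.elim χ χ : ι ⊕ ι → G →+ Spin) i z.2 -
            (Sum.elim c fun i => c i + ((Real.pi : ℝ) : Spin)) i)) =
        (∑ i ∈ s, J i * cosS (χ i z.1)) + ∑ i ∈ s, J' i * cosS (χ i z.2 - c i) := by
      rw [Finset.sum_disjSum, ← Finset.sum_add_distrib, ← Finset.sum_add_distrib]
      refine Finset.sum_congr rfl fun i _ => ?_
      simp only [Sum.elim_inl, Sum.elim_inr, ← sub_sub, cosS_sub_pi]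
      ring
    rw [e1, Real.exp_add, ← sub_sub, cosS_sub_pi]
    ring
  simp_rw [e] at h
  have := hχ
  rw [integral_sub (integrable_of_continuous (by fun_prop))
    (integrable_of_continuous (by fun_prop))] at h
  rw [integral_prod_mul (fun x => cosS (χ₀ x) * Real.exp (∑ i ∈ s, J i * cosS (χ i x)))
    (fun x => Real.exp (∑ i ∈ s, J' i * cosS (χ i x - c i))),
    integral_prod_mul (fun x => Real.exp (∑ i ∈ s, J i * cosS (χ i x)))
      (fun x => cosS (χ₀ x - c₀) * Real.exp (∑ i ∈ s, J' i * cosS (χ i x - c i)))] at h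
  linarith [mul_comm (∫ x, Real.exp (∑ i ∈ s, J i * cosS (χ i x)) ∂μ)
    (∫ x, cosS (χ₀ x - c₀) * Real.exp (∑ i ∈ s, J' i * cosS (χ i x - c i)) ∂μ)]

end Ginibre

/-! ### Rooted trees and cutsets -/

section Tree

variable {V : Type*} {G : SimpleGraph V} {o : V}

theorem exists_adj_dist_add_one (hG : G.Connected) {a b : V} (hab : a ≠ b) :
    ∃ z, G.Adj z b ∧ G.dist a z + 1 = G.dist a b := by
  obtain ⟨p, hp⟩ := hG.exists_walk_length_eq_dist b a
  cases p with
  | nil => exact absurd rfl hab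
  | @cons _ z _ h q =>
    refine ⟨z, h.symm, ?_⟩
    have h1 : G.dist z a ≤ q.length := SimpleGraph.dist_le q
    have h2 : G.dist b a ≤ G.dist b z + G.dist z a := hG.dist_triangle
    have h3 : G.dist b z = 1 := SimpleGraph.dist_eq_one_iff_adj.2 h
    rw [SimpleGraph.Walk.length_cons] at hp
    rw [SimpleGraph.dist_comm (u := a) (v := z), SimpleGraph.dist_comm (u := a) (v := b)]
    omega

theorem dist_le_dist_add_one (hG : G.Connected) (a : V) {x y : V} (h : G.Adj x y) :
    G.dist a y ≤ G.dist a x + 1 := by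
  have h1 : G.dist a y ≤ G.dist a x + G.dist x y := hG.dist_triangle
  rwa [SimpleGraph.dist_eq_one_iff_adj.2 h] at h1

/-- Uniqueness of the parent: geodesics through `y` and `z` are both paths from `o` to `x`, hence
equal. -/
theorem eq_of_adj_of_dist_lt (hG : G.IsTree) {x y z : V} (hy : G.Adj y x) (hz : G.Adj z x)
    (hdy : G.dist o y < G.dist o x) (hdz : G.dist o z < G.dist o x) : y = z := by
  have key : ∀ y, G.Adj y x → G.dist o y < G.dist o x →
      ∃ p : G.Walk o y, ∀ h : G.Adj y x, (p.concat h).IsPath := by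
    intro y hy hdy
    obtain ⟨p, hp⟩ := hG.connected.exists_walk_length_eq_dist o y
    refine ⟨p, fun h => SimpleGraph.Walk.isPath_of_length_eq_dist _ ?_⟩
    have := dist_le_dist_add_one hG.connected o hy
    rw [SimpleGraph.Walk.length_concat]
    omega
  obtain ⟨p, hp⟩ := key y hy hdy
  obtain ⟨q, hq⟩ := key z hz hdz
  have := (hG.existsUnique_path o x).unique (hp hy) (hq hz)
  exact (SimpleGraph.Walk.concat_inj this).1

/-- Geodesics through `y` concatenate to the unique path from `o` to `w`, and any walk contains that
path. -/
theorem mem_support_of_le (hG : G.IsTree) {y w : V} (h : Le G o y w) (p : G.Walk o w) :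
    y ∈ p.support := by
  classical
  obtain ⟨p₁, h₁⟩ := hG.connected.exists_walk_length_eq_dist o y
  obtain ⟨p₂, h₂⟩ := hG.connected.exists_walk_length_eq_dist y w
  have hp : (p₁.append p₂).IsPath := SimpleGraph.Walk.isPath_of_length_eq_dist _ (by
    rw [SimpleGraph.Walk.length_append, h₁, h₂]; exact h)
  have := (hG.existsUnique_path o w).unique hp p.bypass_isPath
  have hy : y ∈ (p₁.append p₂).support := by
    rw [SimpleGraph.Walk.mem_support_append_iff]
    exact Or.inl p₁.end_mem_support
  rw [this] at hy
  exact p.support_bypass_subset_support hy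

theorem mem_component_of_adj {C : Finset V} {a x y : V} (hx : x ∈ component G C a)
    (h : G.Adj x y) (hy : y ∉ C) : y ∈ component G C a := by
  obtain ⟨p, hp⟩ := hx
  refine ⟨p.concat h, fun z hz => ?_⟩
  rw [SimpleGraph.Walk.support_concat, List.mem_append] at hz
  rcases hz with hz | hz
  · exact hp z hz
  · rw [List.mem_singleton] at hz
    exact hz ▸ hy

theorem notMem_of_mem_component {C : Finset V} {a x : V} (hx : x ∈ component G C a) : x ∉ C := by
  obtain ⟨p, hp⟩ := hx
  exact hp x p.end_mem_support

theorem disjoint_inside (C : Finset V) : Disjoint (inside G o C) (C : Set V) :=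
  Set.disjoint_left.2 fun _ hx => notMem_of_mem_component hx

theorem root_mem_inside {C : Finset V} (hC : IsCutset G o C) : o ∈ inside G o C :=
  ⟨SimpleGraph.Walk.nil, by simpa using hC.root_notMem⟩

/-- The only edge leaving the subtree of `v` joins `v` to its parent. -/
theorem eq_of_adj_of_mem_subtree_of_notMem (hG : G.IsTree) {v x y : V} (h : G.Adj x y)
    (hx : x ∈ subtree G o v) (hy : y ∉ subtree G o v) : x = v ∧ G.dist o y + 1 = G.dist o v := by
  have hx' : G.dist o v + G.dist v x = G.dist o x := hx
  have hy' : ¬ G.dist o v + G.dist v y = G.dist o y := hy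
  have h1 : G.dist o y ≤ G.dist o v + G.dist v y := hG.connected.dist_triangle
  have h2 := dist_le_dist_add_one hG.connected v h
  rcases hG.dist_eq_dist_add_one_of_adj o h with h3 | h3
  · by_cases hxv : v = x
    · subst hxv
      exact ⟨rfl, h3.symm⟩
    -- Both `y` and the neighbour of `x` towards `v` are one step closer to the root, so they
    -- coincide, which puts `y` in the subtree.
    · exfalso
      obtain ⟨z, hz, hzd⟩ := exists_adj_dist_add_one hG.connected hxv
      have h4 : G.dist o z ≤ G.dist o v + G.dist v z := hG.connected.dist_triangle
      have h5 : y = z := eq_of_adj_of_dist_lt (o := o) hG h.symm hz (by omega) (by omega)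
      subst h5
      have h6 := dist_le_dist_add_one hG.connected o h.symm
      omega
  · omega

theorem finite_ball [G.LocallyFinite] (hG : G.Connected) (n : ℕ) :
    {v | G.dist o v ≤ n}.Finite := by
  induction n with
  | zero =>
    refine (Set.finite_singleton o).subset fun v hv => ?_
    have : G.dist o v = 0 := Nat.le_zero.1 hv
    exact (hG.dist_eq_zero_iff.1 this).symm
  | succ n ih =>
    refine (ih.union (ih.biUnion fun v _ => (G.neighborSet v).toFinite)).subset fun v hv => ?_
    by_cases h : G.dist o v ≤ n
    · exact Or.inl h
    · right
      have hv' : G.dist o v ≤ n + 1 := hv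
      have hov : o ≠ v := by rintro rfl; simp at h
      obtain ⟨z, hz, hzd⟩ := exists_adj_dist_add_one hG hov
      refine Set.mem_biUnion (show G.dist o z ≤ n by omega) ?_
      exact hz

theorem countable_of_locallyFinite [G.LocallyFinite] (hG : G.Connected) (o : V) : Countable V := by
  rw [← Set.countable_univ_iff]
  have : (Set.univ : Set V) = ⋃ n : ℕ, {v | G.dist o v ≤ n} := by
    ext v
    simp only [Set.mem_univ, Set.mem_iUnion, true_iff]
    exact ⟨_, le_refl (G.dist o v)⟩
  rw [this]
  exact Set.countable_iUnion fun n => (finite_ball hG n).countable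

/-- The inside of a cutset is finite. -/
theorem finite_inside [G.LocallyFinite] (hG : G.IsTree) {C : Finset V} (hC : IsCutset G o C) :
    (inside G o C).Finite := by
  by_contra hinf
  -- König's lemma: always move to a child with infinitely many descendants in the inside. Distances
  -- from the root increase along the resulting ray, so it is self-avoiding.
  let D : V → Set V := fun x => {w ∈ inside G o C | Le G o x w}
  have step : ∀ x, (D x).Infinite →
      ∃ y, (D y).Infinite ∧ G.Adj x y ∧ G.dist o y = G.dist o x + 1 := by
    intro x hx
    by_contra! hno
    refine hx (((Set.finite_singleton x).union
      (((G.neighborSet x).toFinite.sep fun y => G.dist o y = G.dist o x + 1).biUnion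
        fun y hy => Set.not_infinite.1 fun h => hno y h hy.1 hy.2)).subset fun w hw => ?_)
    obtain ⟨hwi, hxw⟩ := hw
    have hxw' : G.dist o x + G.dist x w = G.dist o w := hxw
    by_cases hwx : w = x
    · exact Or.inl hwx
    · right
      obtain ⟨z, hz, hzd⟩ := exists_adj_dist_add_one hG.connected hwx
      have h1 := dist_le_dist_add_one hG.connected o hz.symm
      have h2 : G.dist o w ≤ G.dist o z + G.dist z w := hG.connected.dist_triangle
      rw [SimpleGraph.dist_comm (u := w) (v := z), SimpleGraph.dist_comm (u := w) (v := x)] at hzd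
      refine Set.mem_biUnion (x := z) ⟨hz.symm, by omega⟩ ⟨hwi, ?_⟩
      change G.dist o z + G.dist z w = G.dist o w
      omega
  have hD : (D o).Infinite := by
    have : D o = inside G o C := by
      ext w; simp [D, Le]
    rwa [this]
  choose! nxt h1 h2 h3 using step
  let p : ℕ → V := fun n => nxt^[n] o
  have hp : ∀ n, p (n + 1) = nxt (p n) := fun n => Function.iterate_succ_apply' _ _ _
  have hpD : ∀ n, (D (p n)).Infinite := by
    intro n
    induction n with
    | zero => exact hD
    | succ n ih => rw [hp]; exact h1 _ ih
  have hdist : ∀ n, G.dist o (p n) = n := by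
    intro n
    induction n with
    | zero => exact SimpleGraph.dist_self
    | succ n ih => rw [hp, h3 _ (hpD n), ih]
  obtain ⟨n, hn⟩ := hC.meets p rfl (fun a b hab => by rw [← hdist a, hab, hdist b])
    fun n => by rw [hp]; exact h2 _ (hpD n)
  -- A walk from `o` to an inside vertex below `p n` must visit `p n`, yet it can be chosen to avoid
  -- `C`.
  obtain ⟨w, hw, hle⟩ := (hpD n).nonempty
  obtain ⟨q, hq⟩ := hw
  exact hq _ (mem_support_of_le hG hle q) hn

/-- The sphere of radius `n + 1` works: distances change by at most one per step, so a ray missing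
it would stay in a finite ball. -/
theorem exists_isCutset [G.LocallyFinite] (hG : G.IsTree) (o : V) (n : ℕ) :
    ∃ C : Finset V, IsCutset G o C ∧ ∀ w, G.dist o w ≤ n → w ∈ inside G o C := by
  have hfin : ∀ n, {v | G.dist o v = n}.Finite := fun n =>
    (finite_ball hG.connected n).subset fun v hv => le_of_eq hv
  have hin : ∀ n w, G.dist o w < n → w ∈ inside G o (hfin n).toFinset := by
    intro n w hw
    obtain ⟨p, hp⟩ := hG.connected.exists_walk_length_eq_dist o w
    refine ⟨p, fun x hx => ?_⟩
    have h1 : G.dist o x ≤ p.length := by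
      classical
      exact (SimpleGraph.dist_le (p.takeUntil x hx)).trans (p.length_takeUntil_le_length hx)
    simp only [Set.Finite.mem_toFinset, Set.mem_ofPred_eq]
    omega
  have hcut : ∀ n, IsCutset G o (hfin (n + 1)).toFinset := by
    intro n
    refine ⟨by simp, ?_, ?_⟩
    · intro p hp0 hinj hadj
      by_contra! hno
      have hle : ∀ k, G.dist o (p k) ≤ n := by
        intro k
        induction k with
        | zero => simp [hp0]
        | succ k ih =>
          have h1 := dist_le_dist_add_one hG.connected o (hadj k)
          have h2 : G.dist o (p (k + 1)) ≠ n + 1 := by simpa using hno (k + 1)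
          omega
      exact Set.infinite_of_injective_forall_mem (s := {v | G.dist o v ≤ n}) hinj hle
        (finite_ball hG.connected n)
    · intro x hx y hy hle
      have hx' : G.dist o x = n + 1 := by simpa using hx
      have hy' : G.dist o y = n + 1 := by simpa using hy
      have hle' : G.dist o x + G.dist x y = G.dist o y := hle
      exact hG.connected.dist_eq_zero_iff.1 (by omega)
  exact ⟨_, hcut n, fun w hw => hin _ _ (by omega)⟩

end Tree

/-! ### Configurations, interactions and Gibbs measures -/

section Model

variable {V : Type*}

/-- The product of the uniform measures over all vertices. -/
noncomputable abbrev prior (V : Type*) : Measure (V → Spin) := Measure.infinitePi fun _ : V => unif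

/-- The configuration equal to `ξ` on `Λ` and to `δ` off `Λ`. -/
noncomputable def patch (Λ : Set V) (ξ δ : V → Spin) : V → Spin := glue Λ (Λ.domRestrict ξ) δ

theorem patch_of_mem {Λ : Set V} {x : V} (h : x ∈ Λ) (ξ δ : V → Spin) : patch Λ ξ δ x = ξ x := by
  simp [patch, glue, h]

theorem patch_of_notMem {Λ : Set V} {x : V} (h : x ∉ Λ) (ξ δ : V → Spin) :
    patch Λ ξ δ x = δ x := by
  simp [patch, glue, h]

theorem patch_self (Λ : Set V) (ξ : V → Spin) : patch Λ ξ ξ = ξ := by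
  ext x
  by_cases h : x ∈ Λ
  · rw [patch_of_mem h]
  · rw [patch_of_notMem h]

theorem domRestrict_patch (Λ : Set V) (ξ δ : V → Spin) :
    Λ.domRestrict (patch Λ ξ δ) = Λ.domRestrict ξ :=
  funext fun x => patch_of_mem x.2 ξ δ

theorem domRestrict_patch_of_disjoint {Λ D : Set V} (h : Disjoint Λ D) (ξ δ : V → Spin) :
    D.domRestrict (patch Λ ξ δ) = D.domRestrict δ :=
  funext fun x => patch_of_notMem (Set.disjoint_right.1 h x.2) ξ δ

@[fun_prop]
theorem continuous_patch {X : Type*} [TopologicalSpace X] (Λ : Set V) {f g : X → V → Spin}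
    (hf : Continuous f) (hg : Continuous g) : Continuous fun x => patch Λ (f x) (g x) := by
  refine continuous_pi fun v => ?_
  by_cases h : v ∈ Λ
  · simp_rw [patch_of_mem h]; fun_prop
  · simp_rw [patch_of_notMem h]; fun_prop

theorem measurable_patch (Λ : Set V) :
    Measurable fun z : (V → Spin) × (V → Spin) => patch Λ z.1 z.2 := by
  refine measurable_pi_lambda _ fun v => ?_
  by_cases h : v ∈ Λ
  · simp_rw [patch_of_mem h]; fun_prop
  · simp_rw [patch_of_notMem h]; fun_prop

/-- Resampling the spins in `S` preserves the product measure. -/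
theorem measurePreserving_patch (S : Set V) :
    MeasurePreserving (fun z : (V → Spin) × (V → Spin) => patch S z.1 z.2)
      ((prior V).prod (prior V)) (prior V) := by
  classical
  refine ⟨measurable_patch S, Measure.eq_infinitePi _ fun s t ht => ?_⟩
  rw [Measure.map_apply (measurable_patch S) (.pi s.countable_toSet fun i _ => ht i)]
  have : (fun z : (V → Spin) × (V → Spin) => patch S z.1 z.2) ⁻¹' (Set.pi s t) =
      (Set.pi (s.filter (· ∈ S) : Finset V) t) ×ˢ (Set.pi (s.filter (· ∉ S) : Finset V) t) := by
    ext ⟨η, ξ⟩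
    simp only [Set.mem_preimage, Set.mem_pi, Set.mem_prod, Finset.coe_filter, Finset.mem_coe]
    constructor
    · intro h
      exact ⟨fun i hi => patch_of_mem hi.2 η ξ ▸ h i hi.1,
        fun i hi => patch_of_notMem hi.2 η ξ ▸ h i hi.1⟩
    · rintro ⟨h1, h2⟩ i hi
      by_cases hS : i ∈ S
      · rw [patch_of_mem hS]; exact h1 i ⟨hi, hS⟩
      · rw [patch_of_notMem hS]; exact h2 i ⟨hi, hS⟩
  rw [this, Measure.prod_prod, Measure.infinitePi_pi _ fun i _ => ht i,
    Measure.infinitePi_pi _ fun i _ => ht i, Finset.prod_filter_mul_prod_filter_not]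

theorem exists_pair (e : Sym2 V) : ∃ p : V × V, e = s(p.1, p.2) := by
  induction e with | h x y => exact ⟨(x, y), rfl⟩

theorem pairEnergy_mk (ξ : V → Spin) (x y : V) : pairEnergy ξ s(x, y) = - cosS (ξ x - ξ y) := rfl

@[fun_prop]
theorem continuous_pairEnergy {X : Type*} [TopologicalSpace X] {f : X → V → Spin}
    (hf : Continuous f) (e : Sym2 V) : Continuous fun x => pairEnergy (f x) e := by
  obtain ⟨p, rfl⟩ := exists_pair e
  simp_rw [pairEnergy_mk]
  fun_prop

variable {G : SimpleGraph V}

/-- Minus the energy of a configuration along a finite set of edges. -/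
noncomputable def interaction (J : G.edgeSet → ℝ≥0) (E : Finset G.edgeSet) (ξ : V → Spin) : ℝ :=
  - ∑ e ∈ E, (J e : ℝ) * pairEnergy ξ e

@[fun_prop]
theorem continuous_interaction {X : Type*} [TopologicalSpace X] {f : X → V → Spin}
    (hf : Continuous f) (J : G.edgeSet → ℝ≥0) (E : Finset G.edgeSet) :
    Continuous fun x => interaction J E (f x) := by
  unfold interaction
  fun_prop

theorem interaction_congr {J : G.edgeSet → ℝ≥0} {E : Finset G.edgeSet} {ξ ξ' : V → Spin}
    (h : ∀ e ∈ E, ∀ x ∈ (e : Sym2 V), ξ x = ξ' x) : interaction J E ξ = interaction J E ξ' := by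
  unfold interaction
  congr 1
  refine Finset.sum_congr rfl fun e he => ?_
  obtain ⟨p, hp⟩ := exists_pair (e : Sym2 V)
  have h1 := h e he p.1 (hp ▸ Sym2.mem_mk_left _ _)
  have h2 := h e he p.2 (hp ▸ Sym2.mem_mk_right _ _)
  rw [hp, pairEnergy_mk, pairEnergy_mk, h1, h2]

open Classical in
theorem interaction_sdiff (J : G.edgeSet → ℝ≥0) {E E' : Finset G.edgeSet} (h : E' ⊆ E)
    (ξ : V → Spin) :
    interaction J E ξ = interaction J E' ξ + interaction J (E \ E') ξ := by
  unfold interaction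
  rw [← Finset.sum_sdiff h]
  ring

/-- The edges inside `Λ` and between `Λ` and `D`. -/
def edges (G : SimpleGraph V) (Λ D : Set V) : Set G.edgeSet :=
  {e | (∀ x ∈ (e : Sym2 V), x ∈ Λ) ∨ ∃ x ∈ Λ, ∃ y ∈ D, (e : Sym2 V) = s(x, y)}

theorem mem_or_mem_of_mem_edges {Λ D : Set V} {e : G.edgeSet} (he : e ∈ edges G Λ D) {x : V}
    (hx : x ∈ (e : Sym2 V)) : x ∈ Λ ∨ x ∈ D := by
  rcases he with h | ⟨a, ha, b, hb, h⟩
  · exact Or.inl (h x hx)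
  · rw [h, Sym2.mem_iff] at hx
    rcases hx with rfl | rfl
    · exact Or.inl ha
    · exact Or.inr hb

theorem edges_mono {Λ Λ' D D' : Set V} (hΛ : Λ ⊆ Λ') (hD : D ⊆ Λ' ∪ D') :
    edges G Λ D ⊆ edges G Λ' D' := by
  rintro e (h | ⟨a, ha, b, hb, h⟩)
  · exact Or.inl fun x hx => hΛ (h x hx)
  · rcases hD hb with hb' | hb'
    · left
      intro x hx
      rw [h, Sym2.mem_iff] at hx
      rcases hx with rfl | rfl
      · exact hΛ ha
      · exact hb'
    · exact Or.inr ⟨a, hΛ ha, b, hb', h⟩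

theorem mem_edges_of_forall {Λ D : Set V} {e : G.edgeSet} {x : V} (hx : x ∈ (e : Sym2 V))
    (hxΛ : x ∈ Λ) (h : ∀ y ∈ (e : Sym2 V), G.Adj x y → y ∈ Λ ∨ y ∈ D) : e ∈ edges G Λ D := by
  obtain ⟨y, hy⟩ := hx
  have hadj : G.Adj x y := by
    have := e.2
    rwa [hy, SimpleGraph.mem_edgeSet] at this
  rcases h y (hy ▸ Sym2.mem_mk_right _ _) hadj with h' | h'
  · left
    intro z hz
    rw [hy, Sym2.mem_iff] at hz
    rcases hz with rfl | rfl
    · exact hxΛ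
    · exact h'
  · exact Or.inr ⟨x, hxΛ, y, h', hy⟩

theorem finite_edges [G.LocallyFinite] {Λ : Set V} (hΛ : Λ.Finite) (D : Set V) :
    (edges G Λ D).Finite := by
  have hfin : (⋃ x ∈ Λ, (fun y => s(x, y)) '' (G.neighborSet x)).Finite :=
    hΛ.biUnion fun x _ => ((G.neighborSet x).toFinite.image _)
  refine (hfin.preimage (f := fun e : G.edgeSet => (e : Sym2 V))
    Subtype.val_injective.injOn).subset ?_
  intro e he
  have key : ∃ x ∈ Λ, x ∈ (e : Sym2 V) := by
    rcases he with h | ⟨a, ha, b, hb, h⟩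
    · obtain ⟨p, hp⟩ := exists_pair (e : Sym2 V)
      have : p.1 ∈ (e : Sym2 V) := hp ▸ Sym2.mem_mk_left _ _
      exact ⟨p.1, h _ this, this⟩
    · exact ⟨a, ha, h ▸ Sym2.mem_mk_left _ _⟩
  obtain ⟨x, hx, y, hy⟩ := key
  refine Set.mem_biUnion hx ⟨y, ?_, hy.symm⟩
  have := e.2
  rwa [hy, SimpleGraph.mem_edgeSet] at this

/-- Disjointness of `Λ` and `D` keeps the two kinds of edges apart, so the two `finsum`s merge into
one finite sum. -/
theorem neg_hamiltonian_eq {J : G.edgeSet → ℝ≥0} {Λ D : Set V} (hΛD : Disjoint Λ D)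
    {E : Finset G.edgeSet} (hE : (E : Set G.edgeSet) = edges G Λ D) (δ : V → Spin)
    (η : Λ → Spin) : - hamiltonian G J Λ D δ η = interaction J E (glue Λ η δ) := by
  unfold hamiltonian interaction
  congr 1
  set f : G.edgeSet → ℝ := fun e => (J e : ℝ) * pairEnergy (glue Λ η δ) e
  let A : Set G.edgeSet := {e | ∀ x ∈ (e : Sym2 V), x ∈ Λ}
  let B : Set G.edgeSet := {e | ∃ x ∈ Λ, ∃ y ∈ D, (e : Sym2 V) = s(x, y)}
  have hAB : edges G Λ D = A ∪ B := rfl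
  have hfin : (A ∪ B).Finite := by rw [← hAB, ← hE]; exact E.finite_toSet
  have hdisj : Disjoint A B := by
    refine Set.disjoint_left.2 fun e hA ⟨x, hx, y, hy, h⟩ => ?_
    exact Set.disjoint_left.1 hΛD (hA y (h ▸ Sym2.mem_mk_right _ _)) hy
  rw [← finsum_mem_coe_finset, hE, hAB, finsum_mem_union hdisj
    (hfin.subset Set.subset_union_left) (hfin.subset Set.subset_union_right)]
  rfl

theorem tilted_map {α β : Type*} [MeasurableSpace α] [MeasurableSpace β] {μ : Measure α}
    {f : α → β} (hf : Measurable f) {g : β → ℝ} (hg : Measurable g) :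
    (μ.map f).tilted g = (μ.tilted (g ∘ f)).map f := by
  ext s hs
  rw [Measure.map_apply hf hs, tilted_apply' _ _ hs, tilted_apply' _ _ (hf hs),
    setLIntegral_map hs (by fun_prop) hf, integral_map hf.aemeasurable
      (by exact (Real.measurable_exp.comp hg).aestronglyMeasurable)]
  rfl

/-- The finite-volume Gibbs measures are restrictions of measures on the full configuration
space. -/
theorem gibbs_eq_map {J : G.edgeSet → ℝ≥0} {Λ D : Set V} (hΛD : Disjoint Λ D)
    {E : Finset G.edgeSet} (hE : (E : Set G.edgeSet) = edges G Λ D) (δ : V → Spin)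
    [Countable V] :
    gibbs G J Λ D δ = ((prior V).tilted fun ξ => interaction J E (patch Λ ξ δ)).map
      Λ.domRestrict := by
  unfold gibbs
  have h1 : (fun η => - hamiltonian G J Λ D δ η) = fun η => interaction J E (glue Λ η δ) :=
    funext fun η => neg_hamiltonian_eq hΛD hE δ η
  have hm : Measurable fun η : Λ → Spin => interaction J E (glue Λ η δ) := by
    have : Continuous fun η : Λ → Spin => glue Λ η δ := by
      refine continuous_pi fun v => ?_
      unfold glue
      by_cases h : v ∈ Λ
      · simp only [h, dite_true]; fun_prop
      · simp only [h, dite_false]; fun_prop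
    have : Continuous fun η : Λ → Spin => interaction J E (glue Λ η δ) := by fun_prop
    exact this.measurable
  rw [h1, ← Measure.infinitePi_map_restrict' (fun _ : V => unif) (I := Λ),
    tilted_map (by fun_prop) hm]
  rfl

/-- The vertices off `Λ` being assigned the spin `0`, a configuration on `Λ` as a group
homomorphism. -/
noncomputable def truncate (Λ : Set V) : (V → Spin) →+ (V → Spin) where
  toFun ξ := patch Λ ξ 0
  map_zero' := patch_self Λ 0
  map_add' ξ ξ' := by
    ext x
    by_cases h : x ∈ Λ
    · simp [patch_of_mem h]
    · simp [patch_of_notMem h]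

/-- Separating the homomorphic part from a fixed configuration turns boundary spins into phases, the
form Ginibre's inequality accepts. -/
theorem patch_eq_truncate_add (Λ : Set V) (ξ δ : V → Spin) :
    patch Λ ξ δ = truncate Λ ξ + patch Λ 0 δ := by
  ext x
  by_cases h : x ∈ Λ
  · simp [truncate, patch_of_mem h]
  · simp [truncate, patch_of_notMem h]

/-- For a constant boundary condition the phases cancel in spin differences, at the price of
translating `ξ`. -/
theorem patch_const_eq (Λ : Set V) (ξ : V → Spin) (zero : Spin) :
    patch Λ ξ (fun _ => zero) = truncate Λ (ξ - fun _ => zero) + fun _ => zero := by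
  ext x
  by_cases h : x ∈ Λ
  · simp [truncate, patch_of_mem h]
  · simp [truncate, patch_of_notMem h]

variable [Countable V]

instance : (prior V).IsAddLeftInvariant := by
  refine ⟨fun g => ?_⟩
  have := Measure.infinitePi_map_pi (fun _ : V => unif) (f := fun i x => g i + x)
    (fun i => by fun_prop)
  simp_rw [map_add_left_eq_self] at this
  exact this

instance : (prior V).IsAddHaarMeasure where
  lt_top_of_isCompact := fun K _ => measure_lt_top _ K
  toIsOpenPosMeasure :=
    isOpenPosMeasure_of_addLeftInvariant_of_compact Set.univ isCompact_univ (by simp)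

/-- With respect to constant boundary conditions, arbitrary boundary conditions and a smaller set
of edges decrease the expectation of every cosine. -/
theorem integral_cosS_le (J : G.edgeSet → ℝ≥0) {E E' : Finset G.edgeSet} (hE : E' ⊆ E)
    (Λ : Set V) (δ : V → Spin) (zero : Spin) (m : ℤ) (v : V) (c : Spin) :
    (∫ ξ, cosS (m • ξ v - c) * Real.exp (interaction J E' (patch Λ ξ δ)) ∂(prior V)) *
        ∫ ξ, Real.exp (interaction J E (patch Λ ξ fun _ => zero)) ∂(prior V) ≤
      (∫ ξ, cosS (m • (ξ v - zero)) *
          Real.exp (interaction J E (patch Λ ξ fun _ => zero)) ∂(prior V)) *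
        ∫ ξ, Real.exp (interaction J E' (patch Λ ξ δ)) ∂(prior V) := by
  classical
  choose p hp using fun e : Sym2 V => exists_pair e
  let χ : G.edgeSet → (V → Spin) →+ Spin := fun e =>
    ((Pi.evalAddMonoidHom (fun _ : V => Spin) (p e).1).comp (truncate Λ)) -
      ((Pi.evalAddMonoidHom (fun _ : V => Spin) (p e).2).comp (truncate Λ))
  have hχ : ∀ e ξ, χ e ξ = truncate Λ ξ (p e).1 - truncate Λ ξ (p e).2 := fun e ξ => rfl
  have hpair : ∀ ξ e, pairEnergy ξ e = - cosS (ξ (p e).1 - ξ (p e).2) := fun ξ e =>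
    congrArg (pairEnergy ξ) (hp e)
  have hχc : ∀ e, Continuous (χ e) := by
    intro e
    change Continuous fun ξ => patch Λ ξ 0 (p e).1 - patch Λ ξ 0 (p e).2
    fun_prop
  let cc : G.edgeSet → Spin := fun e => -(patch Λ 0 δ (p e).1 - patch Λ 0 δ (p e).2)
  let χ₀ : (V → Spin) →+ Spin :=
    (zsmulAddGroupHom m).comp (Pi.evalAddMonoidHom (fun _ : V => Spin) v)
  have hdiv : ∀ x : V → Spin, ∃ y, y + y = x := by
    intro x
    choose y hy using fun i => exists_half (x i)
    exact ⟨y, funext hy⟩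
  -- Deleting the edges outside `E'` means setting their couplings to zero; the compact group is the
  -- whole configuration space.
  have key := ginibre_comparison hdiv (prior V) E (fun e => (J e : ℝ))
    (fun e => if e ∈ E' then (J e : ℝ) else 0)
    (fun e _ => by positivity) (fun e _ => by split_ifs <;> simp)
    χ hχc cc χ₀ (by change Continuous fun ξ : V → Spin => m • ξ v; fun_prop) c
  have e1 : ∀ ξ, ∑ e ∈ E, (if e ∈ E' then (J e : ℝ) else 0) * cosS (χ e ξ - cc e) =
      interaction J E' (patch Λ ξ δ) := by
    intro ξ
    unfold interaction
    simp_rw [ite_mul, zero_mul]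
    rw [← Finset.sum_filter, Finset.filter_mem_eq_inter, Finset.inter_eq_right.2 hE,
      ← Finset.sum_neg_distrib]
    refine Finset.sum_congr rfl fun e _ => ?_
    rw [hpair, mul_neg, neg_neg, hχ, patch_eq_truncate_add]
    congr 2
    simp only [cc, Pi.add_apply]
    abel
  have e2 : ∀ ξ, ∑ e ∈ E, (J e : ℝ) * cosS (χ e (ξ - fun _ => zero)) =
      interaction J E (patch Λ ξ fun _ => zero) := by
    intro ξ
    unfold interaction
    rw [← Finset.sum_neg_distrib]
    refine Finset.sum_congr rfl fun e _ => ?_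
    rw [hpair, mul_neg, neg_neg, hχ, patch_const_eq]
    congr 2
    simp only [Pi.add_apply]
    abel
  simp_rw [e1] at key
  rw [← integral_sub_right_eq_self (fun ξ => Real.exp (∑ e ∈ E, (J e : ℝ) * cosS (χ e ξ)))
    (fun _ => zero),
    ← integral_sub_right_eq_self (fun ξ => cosS (χ₀ ξ) *
      Real.exp (∑ e ∈ E, (J e : ℝ) * cosS (χ e ξ))) (fun _ => zero)] at key
  simp_rw [e2] at key
  exact key

theorem integrable_exp_interaction (J : G.edgeSet → ℝ≥0) (E : Finset G.edgeSet) (Λ : Set V)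
    (δ : V → Spin) :
    Integrable (fun ξ => Real.exp (interaction J E (patch Λ ξ δ))) (prior V) :=
  integrable_of_continuous (by fun_prop)

theorem integral_exp_interaction_pos (J : G.edgeSet → ℝ≥0) (E : Finset G.edgeSet) (Λ : Set V)
    (δ : V → Spin) : 0 < ∫ ξ, Real.exp (interaction J E (patch Λ ξ δ)) ∂(prior V) :=
  integral_exp_pos (integrable_exp_interaction J E Λ δ)

theorem integral_tilted_eq_div {X : Type*} [MeasurableSpace X] (μ : Measure X) (h g : X → ℝ) :
    ∫ x, g x ∂(μ.tilted h) = (∫ x, g x * Real.exp (h x) ∂μ) / ∫ x, Real.exp (h x) ∂μ := by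
  rw [integral_tilted, ← integral_div]
  congr 1 with x
  rw [smul_eq_mul]
  ring

end Model

/-! ### Fourier analysis on the circle -/

theorem exists_zsmul_eq_pi {m : ℤ} (hm : m ≠ 0) : ∃ t : Spin, m • t = ((Real.pi : ℝ) : Spin) := by
  refine ⟨((Real.pi / m : ℝ) : Spin), ?_⟩
  rw [← QuotientAddGroup.mk_zsmul, zsmul_eq_mul, mul_div_cancel₀ _ (by exact_mod_cast hm)]

/-- Translation by `π / m` changes the sign of the integrand. -/
theorem integral_cosS_zsmul (ν : Measure Spin) [ν.IsAddLeftInvariant] {m : ℤ} (hm : m ≠ 0)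
    (c : Spin) : ∫ θ, cosS (m • θ - c) ∂ν = 0 := by
  obtain ⟨t, ht⟩ := exists_zsmul_eq_pi hm
  have h := integral_add_right_eq_self (μ := ν) (fun θ => cosS (m • θ - c)) t
  have : ∀ θ : Spin, cosS (m • (θ + t) - c) = - cosS (m • θ - c) := by
    intro θ
    rw [← cosS_add_pi, smul_add, ht]
    congr 1
    abel
  simp_rw [this, integral_neg] at h
  linarith

theorem fourier_eq_cosS (m : ℤ) (θ : Spin) :
    fourier m θ = ((cosS (m • θ - 0) : ℝ) : ℂ) +
      ((cosS (m • θ - ((Real.pi / 2 : ℝ) : Spin)) : ℝ) : ℂ) * Complex.I := by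
  rw [fourier_apply, sub_zero]
  generalize m • θ = φ
  induction φ using QuotientAddGroup.induction_on with | H x => ?_
  change ((AddCircle.toCircle (x : Spin) : Circle) : ℂ) = ((Real.cos x : ℝ) : ℂ) +
    ((Real.cos (x - Real.pi / 2) : ℝ) : ℂ) * Complex.I
  rw [AddCircle.toCircle_apply_mk, Circle.coe_exp, Real.cos_sub_pi_div_two,
    div_self (by positivity), one_mul, Complex.exp_mul_I, Complex.ofReal_cos, Complex.ofReal_sin]

/-- Measures on the circle all of whose nontrivial Fourier coefficients tend to `0` converge
weakly to the uniform measure. -/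
theorem tendsto_integral_of_tendsto_cosS {ι : Type*} {l : Filter ι} (ν : ι → Measure Spin)
    [∀ i, IsProbabilityMeasure (ν i)]
    (h : ∀ m : ℤ, m ≠ 0 → ∀ c, Tendsto (fun i => ∫ θ, cosS (m • θ - c) ∂(ν i)) l (nhds 0))
    (F : C(Spin, ℝ)) : Tendsto (fun i => ∫ θ, F θ ∂(ν i)) l (nhds (∫ θ, F θ ∂unif)) := by
  let p : C(Spin, ℂ) → Prop := fun F =>
    Tendsto (fun i => ∫ θ, F θ ∂(ν i)) l (nhds (∫ θ, F θ ∂unif))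
  have hint : ∀ (F : C(Spin, ℂ)) (μ : Measure Spin) [IsFiniteMeasure μ], Integrable F μ :=
    fun F μ _ => integrable_of_continuous F.continuous
  have hspan : ∀ F ∈ Submodule.span ℂ (Set.range (@fourier (2 * Real.pi))), p F := by
    intro F hF
    induction hF using Submodule.span_induction with
    | mem F hF =>
      obtain ⟨m, rfl⟩ := hF
      have e : ∀ (μ : Measure Spin) [IsProbabilityMeasure μ], ∫ θ, fourier m θ ∂μ =
          ((∫ θ, cosS (m • θ - 0) ∂μ : ℝ) : ℂ) +
            ((∫ θ, cosS (m • θ - ((Real.pi / 2 : ℝ) : Spin)) ∂μ : ℝ) : ℂ) * Complex.I := by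
        intro μ _
        simp_rw [fourier_eq_cosS]
        rw [integral_add (integrable_of_continuous (by fun_prop))
          (integrable_of_continuous (by fun_prop)), integral_mul_const, integral_complex_ofReal,
          integral_complex_ofReal]
      simp only [p, e]
      by_cases hm : m = 0
      · subst hm
        simp only [zero_smul, integral_const, probReal_univ, one_smul]
        exact tendsto_const_nhds
      · rw [integral_cosS_zsmul unif hm, integral_cosS_zsmul unif hm]
        exact ((Complex.continuous_ofReal.tendsto 0).comp (h m hm 0)).add
          (((Complex.continuous_ofReal.tendsto 0).comp (h m hm _)).mul_const _)
    | zero => simpa [p] using tendsto_const_nhds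
    | add F F' _ _ hF hF' =>
      have e : ∀ (μ : Measure Spin) [IsProbabilityMeasure μ], ∫ θ, (F + F') θ ∂μ =
          ∫ θ, F θ ∂μ + ∫ θ, F' θ ∂μ := fun μ _ => integral_add (hint F μ) (hint F' μ)
      simp only [p, e]
      exact hF.add hF'
    | smul a F _ hF =>
      have e : ∀ (μ : Measure Spin), ∫ θ, (a • F) θ ∂μ = a • ∫ θ, F θ ∂μ :=
        fun μ => integral_smul a F
      simp only [p, e]
      exact hF.const_smul a
  -- Trigonometric polynomials are uniformly dense, and integrals against probability measures are
  -- 1-Lipschitz in the sup norm.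
  have hall : ∀ F : C(Spin, ℂ), p F := by
    intro F
    have hF : F ∈ closure ((Submodule.span ℂ (Set.range (@fourier (2 * Real.pi))) :
        Submodule ℂ C(Spin, ℂ)) : Set C(Spin, ℂ)) := by
      rw [← Submodule.topologicalClosure_coe, span_fourier_closure_eq_top]
      trivial
    refine Metric.tendsto_nhds.2 fun ε hε => ?_
    obtain ⟨F', hF', hd⟩ := Metric.mem_closure_iff.1 hF (ε / 3) (by positivity)
    filter_upwards [Metric.tendsto_nhds.1 (hspan F' hF') (ε / 3) (by positivity)] with i hi
    have e : ∀ (μ : Measure Spin) [IsProbabilityMeasure μ],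
        dist (∫ θ, F θ ∂μ) (∫ θ, F' θ ∂μ) ≤ ε / 3 := by
      intro μ _
      rw [dist_eq_norm, ← integral_sub (hint F μ) (hint F' μ)]
      refine (norm_integral_le_of_norm_le_const (C := ε / 3)
        (Eventually.of_forall fun θ => ?_)).trans_eq (by simp)
      rw [← dist_eq_norm]
      exact (ContinuousMap.dist_apply_le_dist θ).trans hd.le
    calc dist (∫ θ, F θ ∂(ν i)) (∫ θ, F θ ∂unif)
        ≤ dist (∫ θ, F θ ∂(ν i)) (∫ θ, F' θ ∂(ν i)) + dist (∫ θ, F' θ ∂(ν i)) (∫ θ, F' θ ∂unif) +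
          dist (∫ θ, F' θ ∂unif) (∫ θ, F θ ∂unif) := dist_triangle4 _ _ _ _
      _ < ε := by
        have h1 := e (ν i)
        have h2 := e unif
        rw [dist_comm] at h2
        linarith
  have := hall ⟨fun θ => ((F θ : ℝ) : ℂ), by fun_prop⟩
  simp only [p, ContinuousMap.coe_mk, integral_complex_ofReal] at this
  exact (Complex.continuous_re.tendsto _).comp this

theorem eq_unif_of_integral_cosS_eq_zero (ν : Measure Spin) [IsProbabilityMeasure ν]
    (h : ∀ m : ℤ, m ≠ 0 → ∀ c, ∫ θ, cosS (m • θ - c) ∂ν = 0) : ν = unif := by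
  refine ext_of_forall_integral_eq_of_IsFiniteMeasure fun F => ?_
  -- A constant family: its weak limit is both `ν` and `unif`.
  have := tendsto_integral_of_tendsto_cosS (l := (pure () : Filter Unit)) (fun _ => ν)
    (fun m hm c => by simp [h m hm c]) F.toContinuousMap
  exact tendsto_nhds_unique tendsto_const_nhds this

/-- Convolution with an even kernel maps a character to a multiple of itself. -/
theorem integral_cosS_mul_kernel (m : ℤ) (c φ : Spin) (J : ℝ) :
    ∫ θ, cosS (m • θ - c) * Real.exp (J * cosS (θ - φ)) ∂unif =
      cosS (m • φ - c) * ∫ θ, cosS (m • θ) * Real.exp (J * cosS θ) ∂unif := by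
  have h1 := integral_add_right_eq_self (μ := unif)
    (fun θ => cosS (m • θ - c) * Real.exp (J * cosS (θ - φ))) φ
  -- Averaging over `θ ↦ -θ`, under which the kernel is even, cancels the sine part and leaves a
  -- multiple of the character.
  have h2 := integral_neg_eq_self (μ := unif)
    (fun θ => cosS (m • (θ + φ) - c) * Real.exp (J * cosS (θ + φ - φ)))
  have h3 : ∀ θ : Spin, cosS (m • (θ + φ) - c) * Real.exp (J * cosS (θ + φ - φ)) +
      cosS (m • (-θ + φ) - c) * Real.exp (J * cosS (-θ + φ - φ)) =
      (2 * cosS (m • φ - c)) * (cosS (m • θ) * Real.exp (J * cosS θ)) := by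
    intro θ
    rw [add_sub_cancel_right, add_sub_cancel_right, cosS_neg, ← add_mul, ← mul_assoc,
      ← cosS_add_add_cosS_sub]
    congr 3
    · rw [smul_add]; abel
    · rw [smul_add, smul_neg]; abel
  have h4 : ∫ θ, (cosS (m • (θ + φ) - c) * Real.exp (J * cosS (θ + φ - φ)) +
      cosS (m • (-θ + φ) - c) * Real.exp (J * cosS (-θ + φ - φ))) ∂unif =
      2 * cosS (m • φ - c) * ∫ θ, cosS (m • θ) * Real.exp (J * cosS θ) ∂unif := by
    simp_rw [h3]
    rw [integral_const_mul]
  rw [integral_add (integrable_of_continuous (by fun_prop))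
    (integrable_of_continuous (by fun_prop)), h2, h1] at h4
  linarith

/-! ### Expectations of cosines -/

section Expectation

variable {V : Type*} {G : SimpleGraph V} {o : V}

/-- The Gibbs measure on `Λ` for the edges in `E`, extended to all vertices by independent uniform
spins. -/
noncomputable def extendedGibbs (J : G.edgeSet → ℝ≥0) (E : Finset G.edgeSet) (Λ : Set V)
    (δ : V → Spin) : Measure (V → Spin) :=
  (prior V).tilted fun ξ => interaction J E (patch Λ ξ δ)

theorem extendedGibbs_absolutelyContinuous (J : G.edgeSet → ℝ≥0) (E : Finset G.edgeSet)
    (Λ : Set V) (δ : V → Spin) : extendedGibbs J E Λ δ ≪ prior V :=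
  tilted_absolutelyContinuous _ _

theorem disjoint_inside_subtree (C : Finset V) (v : V) :
    Disjoint (inside G o C ∩ subtree G o v) (C ∩ subtree G o v) :=
  (disjoint_inside C).mono Set.inter_subset_left Set.inter_subset_left

/-- Ensures that the Radon–Nikodym derivative in `density` carries the whole marginal. -/
theorem map_eval_absolutelyContinuous (J : G.edgeSet → ℝ≥0) (E : Finset G.edgeSet)
    (Λ : Set V) (δ : V → Spin) (v : V) :
    (extendedGibbs J E Λ δ).map (fun ξ => ξ v) ≪ unif := by
  have := (extendedGibbs_absolutelyContinuous J E Λ δ).map (measurable_pi_apply v)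
  rwa [Measure.infinitePi_map_eval] at this

variable [Countable V]

instance (J : G.edgeSet → ℝ≥0) (E : Finset G.edgeSet) (Λ : Set V) (δ : V → Spin) :
    IsProbabilityMeasure (extendedGibbs J E Λ δ) :=
  isProbabilityMeasure_tilted (integrable_exp_interaction J E Λ δ)

/-- The expectation of `cos (m ξ(v) - c)`. -/
noncomputable def cosExp (J : G.edgeSet → ℝ≥0) (E : Finset G.edgeSet) (Λ : Set V)
    (δ : V → Spin) (m : ℤ) (v : V) (c : Spin) : ℝ :=
  ∫ ξ, cosS (m • ξ v - c) ∂(extendedGibbs J E Λ δ)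

/-- The expectation of `cos (m (ξ(v) - zero))` with constant boundary condition `zero`. -/
noncomputable def plusExp (J : G.edgeSet → ℝ≥0) (E : Finset G.edgeSet) (Λ : Set V)
    (zero : Spin) (m : ℤ) (v : V) : ℝ :=
  cosExp J E Λ (fun _ => zero) m v (m • zero)

theorem cosExp_le_plusExp (J : G.edgeSet → ℝ≥0) {E E' : Finset G.edgeSet} (hE : E' ⊆ E)
    (Λ : Set V) (δ : V → Spin) (zero : Spin) (m : ℤ) (v : V) (c : Spin) :
    cosExp J E' Λ δ m v c ≤ plusExp J E Λ zero m v := by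
  unfold plusExp cosExp extendedGibbs
  rw [integral_tilted_eq_div, integral_tilted_eq_div, div_le_div_iff₀
    (integral_exp_interaction_pos J E' Λ δ) (integral_exp_interaction_pos J E Λ _)]
  have := integral_cosS_le J hE Λ δ zero m v c
  simp_rw [smul_sub] at this
  exact this

/-- The one-sided bound holds for every phase, and shifting `c` by `π` reverses the sign of the left
side. -/
theorem abs_cosExp_le_plusExp (J : G.edgeSet → ℝ≥0) {E E' : Finset G.edgeSet} (hE : E' ⊆ E)
    (Λ : Set V) (δ : V → Spin) (zero : Spin) (m : ℤ) (v : V) (c : Spin) :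
    |cosExp J E' Λ δ m v c| ≤ plusExp J E Λ zero m v := by
  refine abs_le.2 ⟨?_, cosExp_le_plusExp J hE Λ δ zero m v c⟩
  have := cosExp_le_plusExp J hE Λ δ zero m v (c + ((Real.pi : ℝ) : Spin))
  have e : cosExp J E' Λ δ m v (c + ((Real.pi : ℝ) : Spin)) = - cosExp J E' Λ δ m v c := by
    unfold cosExp
    rw [← integral_neg]
    simp_rw [← sub_sub, cosS_sub_pi]
  linarith

theorem plusExp_nonneg (J : G.edgeSet → ℝ≥0) (E : Finset G.edgeSet) (Λ : Set V)
    (zero : Spin) (m : ℤ) (v : V) : 0 ≤ plusExp J E Λ zero m v :=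
  (abs_nonneg _).trans (abs_cosExp_le_plusExp J (subset_refl E) Λ (fun _ => zero) zero m v 0)

/-- Integration over the spins in `S` first. -/
theorem integral_prior_patch (S : Set V) {F : (V → Spin) → ℝ} (hF : Continuous F) :
    ∫ ξ, F ξ ∂(prior V) = ∫ ξ, ∫ η, F (patch S η ξ) ∂(prior V) ∂(prior V) := by
  rw [← (measurePreserving_patch S).map_eq, integral_map (measurable_patch S).aemeasurable
    hF.aestronglyMeasurable, (measurePreserving_patch S).map_eq, integral_prod_symm]
  exact integrable_of_continuous (by fun_prop)

theorem integral_prior_patch_le (S : Set V) {F g : (V → Spin) → ℝ} (hF : Continuous F)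
    (hg : Continuous g) (h : ∀ ξ, ∫ η, F (patch S η ξ) ∂(prior V) ≤ g ξ) :
    ∫ ξ, F ξ ∂(prior V) ≤ ∫ ξ, g ξ ∂(prior V) := by
  rw [integral_prior_patch S hF]
  refine integral_mono ?_ (integrable_of_continuous hg) h
  exact (integrable_of_continuous (f := fun z : (V → Spin) × (V → Spin) => F (patch S z.1 z.2))
    (by fun_prop)).integral_prod_right

theorem le_integral_prior_patch (S : Set V) {F g : (V → Spin) → ℝ} (hF : Continuous F)
    (hg : Continuous g) (h : ∀ ξ, g ξ ≤ ∫ η, F (patch S η ξ) ∂(prior V)) :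
    ∫ ξ, g ξ ∂(prior V) ≤ ∫ ξ, F ξ ∂(prior V) := by
  have := integral_prior_patch_le S hF.neg hg.neg fun ξ => by
    simpa only [Pi.neg_apply, integral_neg, neg_le_neg_iff] using h ξ
  simpa only [Pi.neg_apply, integral_neg, neg_le_neg_iff] using this

theorem density_eq (J : G.edgeSet → ℝ≥0) (C : Finset V) (δ : V → Spin) (v : V)
    (hv : v ∈ inside G o C) {E : Finset G.edgeSet}
    (hE : (E : Set G.edgeSet) = edges G (inside G o C ∩ subtree G o v) (C ∩ subtree G o v))
    (θ : Spin) : density G o J C δ v hv θ =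
      (((extendedGibbs J E (inside G o C ∩ subtree G o v) δ).map
        fun ξ => ξ v).rnDeriv unif θ).toReal := by
  unfold density extendedGibbs
  rw [gibbs_eq_map (disjoint_inside_subtree C v) hE, Measure.map_map (by fun_prop) (by fun_prop)]
  rfl

theorem integral_mul_density (J : G.edgeSet → ℝ≥0) (C : Finset V) (δ : V → Spin) (v : V)
    (hv : v ∈ inside G o C) {E : Finset G.edgeSet}
    (hE : (E : Set G.edgeSet) = edges G (inside G o C ∩ subtree G o v) (C ∩ subtree G o v))
    {g : Spin → ℝ} (hg : Continuous g) :
    ∫ ξ, g (ξ v) ∂(extendedGibbs J E (inside G o C ∩ subtree G o v) δ) =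
      ∫ θ, density G o J C δ v hv θ * g θ ∂unif := by
  simp_rw [density_eq J C δ v hv hE]
  rw [integral_toReal_rnDeriv_mul (map_eval_absolutelyContinuous J E _ δ v),
    integral_map (measurable_pi_apply v).aemeasurable hg.aestronglyMeasurable]

theorem integrable_density (J : G.edgeSet → ℝ≥0) (C : Finset V) (δ : V → Spin) (v : V)
    (hv : v ∈ inside G o C) {E : Finset G.edgeSet}
    (hE : (E : Set G.edgeSet) = edges G (inside G o C ∩ subtree G o v) (C ∩ subtree G o v)) :
    Integrable (density G o J C δ v hv) unif := by
  rw [funext (density_eq J C δ v hv hE)]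
  have : IsProbabilityMeasure ((extendedGibbs J E (inside G o C ∩ subtree G o v) δ).map
        fun ξ => ξ v) := Measure.isProbabilityMeasure_map (measurable_pi_apply v).aemeasurable
  exact Measure.integrable_toReal_rnDeriv

/-- If the density at `v` is close to `1`, then expectations are close to those for the uniform
measure. -/
theorem integral_subtree_le (J : G.edgeSet → ℝ≥0) (C : Finset V) (δ : V → Spin) (v : V)
    (hv : v ∈ inside G o C) {E : Finset G.edgeSet}
    (hE : (E : Set G.edgeSet) = edges G (inside G o C ∩ subtree G o v) (C ∩ subtree G o v))
    {ε : ℝ} (hε : ∀ᵐ θ ∂unif, |density G o J C δ v hv θ - 1| ≤ ε)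
    {g : Spin → ℝ} (hg : Continuous g) {M : ℝ} (hM : ∀ θ, |g θ| ≤ M) :
    ∫ ξ, g (ξ v) ∂(extendedGibbs J E (inside G o C ∩ subtree G o v) δ) ≤
      ∫ θ, g θ ∂unif + M * ε := by
  rw [integral_mul_density J C δ v hv hE hg]
  have hint : Integrable (fun θ => density G o J C δ v hv θ * g θ) unif :=
    (integrable_density J C δ v hv hE).mul_bdd (c := M) hg.aestronglyMeasurable
      (Eventually.of_forall hM)
  have hgi : Integrable g unif := integrable_of_continuous hg
  have : ∫ θ, (density G o J C δ v hv θ * g θ - g θ) ∂unif ≤ ∫ _θ, M * ε ∂(unif : Measure Spin) := by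
    refine integral_mono_ae (hint.sub hgi) (integrable_const _) ?_
    filter_upwards [hε] with θ hθ
    have h1 : density G o J C δ v hv θ * g θ - g θ = g θ * (density G o J C δ v hv θ - 1) := by
      ring
    rw [h1]
    refine (le_abs_self _).trans ?_
    rw [abs_mul]
    exact mul_le_mul (hM θ) hθ (abs_nonneg _) ((abs_nonneg _).trans (hM θ))
  rw [integral_sub hint hgi, integral_const, probReal_univ, one_smul] at this
  linarith

end Expectation

/-! ### Passing from a vertex to its child -/

section Decoupling

variable {V : Type*} {G : SimpleGraph V} {o : V}

theorem edges_subtree_subset (C : Finset V) (v : V) :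
    edges G (inside G o C ∩ subtree G o v) (C ∩ subtree G o v) ⊆ edges G (inside G o C) C :=
  edges_mono Set.inter_subset_left fun _ hx => Or.inr hx.1

/-- The boundary configuration of the whole region may replace that of the subtree. -/
theorem interaction_subtree (J : G.edgeSet → ℝ≥0) (C : Finset V) (v : V)
    {E : Finset G.edgeSet}
    (hE : (E : Set G.edgeSet) = edges G (inside G o C ∩ subtree G o v) (C ∩ subtree G o v))
    (ξ δ : V → Spin) : interaction J E (patch (inside G o C) ξ δ) =
      interaction J E (patch (inside G o C ∩ subtree G o v) ξ δ) := by
  refine interaction_congr fun e he x hx => ?_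
  rcases mem_or_mem_of_mem_edges (hE ▸ (Finset.mem_coe.2 he) : e ∈ edges G _ _) hx with h | h
  · rw [patch_of_mem h, patch_of_mem h.1]
  · rw [patch_of_notMem (Set.disjoint_right.1 (disjoint_inside C) h.1),
      patch_of_notMem (Set.disjoint_right.1 (disjoint_inside_subtree C v) h)]

/-- The Gibbs weight factorizes over the subtree of `v`, the edge from `v` to its parent `u`, and
the other edges. -/
theorem exists_factorization (hG : G.IsTree) (J : G.edgeSet → ℝ≥0) (C : Finset V) (zero : Spin)
    {u v : V} (hu : u ∈ inside G o C) (hv : v ∈ inside G o C) (huv : G.Adj u v)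
    (hd : G.dist o u + 1 = G.dist o v)
    {E : Finset G.edgeSet} (hE : (E : Set G.edgeSet) = edges G (inside G o C) C)
    {E₁ : Finset G.edgeSet}
    (hE₁ : (E₁ : Set G.edgeSet) =
      edges G (inside G o C ∩ subtree G o v) (C ∩ subtree G o v)) :
    ∃ E₂ ⊆ E, ∀ η ξ, interaction J E (patch (inside G o C)
        (patch (inside G o C ∩ subtree G o v) η ξ) fun _ => zero) =
      interaction J E₂ (patch (inside G o C) ξ fun _ => zero) +
        ((J ⟨s(u, v), huv⟩ : ℝ) * cosS (η v - ξ u) +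
        interaction J E₁ (patch (inside G o C ∩ subtree G o v) η fun _ => zero)) := by
  classical
  set Λ := inside G o C
  set T := subtree G o v
  set e₀ : G.edgeSet := ⟨s(u, v), huv⟩
  have huT : u ∉ T := by
    intro h
    have h' : G.dist o v + G.dist v u = G.dist o u := h
    omega
  have hvΛT : v ∈ Λ ∩ T := ⟨hv, mem_subtree_self G o v⟩
  have huΛT : u ∉ Λ ∩ T := fun h => huT h.2
  have he₀ : e₀ ∈ E := by
    rw [← Finset.mem_coe, hE]
    left
    intro x hx
    rcases Sym2.mem_iff.1 hx with rfl | rfl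
    · exact hu
    · exact hv
  have hE₁E : E₁ ⊆ E := by
    rw [← Finset.coe_subset, hE₁, hE]
    exact edges_subtree_subset C v
  have he₀' : e₀ ∉ E₁ := by
    rw [← Finset.mem_coe, hE₁]
    intro h
    rcases mem_or_mem_of_mem_edges h (Sym2.mem_mk_left u v) with h | h
    · exact huT h.2
    · exact huT h.2
  have hsub : insert e₀ E₁ ⊆ E := Finset.insert_subset he₀ hE₁E
  refine ⟨E \ insert e₀ E₁, Finset.sdiff_subset, fun η ξ => ?_⟩
  rw [interaction_sdiff J hsub, add_comm]
  congr 1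
  · refine interaction_congr fun e he x hx => ?_
    rw [Finset.mem_sdiff, Finset.mem_insert, not_or] at he
    obtain ⟨heE, hne₀, hne₁⟩ := he
    by_cases hxΛ : x ∈ Λ
    · rw [patch_of_mem hxΛ, patch_of_mem hxΛ]
      -- An edge of `E` touching `Λ ∩ T` is `e₀` or stays in the subtree, hence in `E₁`; so the
      -- remaining edges do not see `η`.
      by_cases hxT : x ∈ T
      · exfalso
        apply hne₁
        rw [← Finset.mem_coe, hE₁]
        refine mem_edges_of_forall hx ⟨hxΛ, hxT⟩ fun y hy hadj => ?_
        have hyT : y ∈ T := by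
          by_contra hyT
          obtain ⟨rfl, h2⟩ := eq_of_adj_of_mem_subtree_of_notMem hG hadj hxT hyT
          have h3 : y = u := eq_of_adj_of_dist_lt (o := o) hG hadj.symm huv (by omega) (by omega)
          subst h3
          apply hne₀
          apply Subtype.ext
          exact (Sym2.mem_and_mem_iff hadj.symm.ne).1 ⟨hy, hx⟩
        rcases mem_or_mem_of_mem_edges (hE ▸ (Finset.mem_coe.2 heE) : e ∈ edges G _ _) hy
          with h | h
        · exact Or.inl ⟨h, hyT⟩
        · exact Or.inr ⟨h, hyT⟩
      · exact patch_of_notMem (fun h => hxT h.2) _ _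
    · rw [patch_of_notMem hxΛ, patch_of_notMem hxΛ]
  · have h1 : ∀ ζ : V → Spin, interaction J (insert e₀ E₁) ζ =
        (J e₀ : ℝ) * cosS (ζ v - ζ u) + interaction J E₁ ζ := by
      intro ζ
      unfold interaction
      rw [Finset.sum_insert he₀']
      change -((J e₀ : ℝ) * pairEnergy ζ s(u, v) + _) = _
      rw [Sym2.eq_swap, pairEnergy_mk]
      ring
    rw [h1, patch_of_mem hv, patch_of_mem hu, patch_of_mem hvΛT, patch_of_notMem huΛT, interaction_subtree J C v hE₁]
    congr 1
    refine interaction_congr fun e he x hx => ?_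
    by_cases h : x ∈ Λ ∩ T
    · rw [patch_of_mem h, patch_of_mem h, patch_of_mem h]
    · rw [patch_of_notMem h, patch_of_notMem h]

variable [Countable V]

/-- Expectations at `v` are controlled by those at its parent `u` and by the density at `v`. -/
theorem plusExp_le_of_parent (hG : G.IsTree) (J : G.edgeSet → ℝ≥0) (C : Finset V) (zero : Spin)
    {u v : V} (hu : u ∈ inside G o C) (hv : v ∈ inside G o C) (huv : G.Adj u v)
    (hd : G.dist o u + 1 = G.dist o v)
    {E : Finset G.edgeSet} (hE : (E : Set G.edgeSet) = edges G (inside G o C) C)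
    {ε : ℝ} (hε₀ : 0 ≤ ε)
    (hε : ∀ᵐ θ ∂unif, |density G o J C (fun _ => zero) v hv θ - 1| ≤ ε) (m : ℤ) :
    plusExp J E (inside G o C) zero m v ≤
      Real.exp (2 * (J ⟨s(u, v), huv⟩ : ℝ)) * (plusExp J E (inside G o C) zero m u + ε) := by
  set Λ := inside G o C
  set S := inside G o C ∩ subtree G o v
  set j : ℝ := (J ⟨s(u, v), huv⟩ : ℝ)
  have hj : 0 ≤ j := NNReal.coe_nonneg _
  obtain ⟨E₁, hE₁⟩ := ((hE ▸ E.finite_toSet).subset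
    (edges_subtree_subset C v) : (edges G S (C ∩ subtree G o v)).Finite).exists_finset_coe
  obtain ⟨E₂, hE₂, hfac⟩ := exists_factorization hG J C zero hu hv huv hd hE hE₁
  let R : (V → Spin) → ℝ := fun ξ => Real.exp (interaction J E₂ (patch Λ ξ fun _ => zero))
  let Q : (V → Spin) → ℝ := fun η => Real.exp (interaction J E₁ (patch S η fun _ => zero))
  have hRc : Continuous R := by fun_prop
  have hQc : Continuous Q := by fun_prop
  have hQ : 0 < ∫ η, Q η ∂(prior V) := integral_exp_interaction_pos J E₁ S _
  have hR : 0 < ∫ ξ, R ξ ∂(prior V) := integral_exp_interaction_pos J E₂ Λ _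
  have hW : ∀ η ξ, Real.exp (interaction J E (patch Λ (patch S η ξ) fun _ => zero)) =
      R ξ * (Real.exp (j * cosS (η v - ξ u)) * Q η) := by
    intro η ξ
    rw [hfac, Real.exp_add, Real.exp_add]
  have hvS : v ∈ S := ⟨hv, mem_subtree_self G o v⟩
  have hexp : ∀ θ : Spin, Real.exp (j * cosS θ) ≤ Real.exp j := by
    intro θ
    refine Real.exp_le_exp.2 ?_
    have := (abs_le.1 (abs_cosS_le_one θ)).2
    nlinarith
  have hexp' : ∀ θ : Spin, Real.exp (-j) ≤ Real.exp (j * cosS θ) := by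
    intro θ
    refine Real.exp_le_exp.2 ?_
    have := (abs_le.1 (abs_cosS_le_one θ)).1
    nlinarith
  -- The factor by which the edge kernel multiplies the `m`-th character.
  set κ : ℝ := ∫ θ, cosS (m • θ) * Real.exp (j * cosS θ) ∂unif
  have hκ : |κ| ≤ Real.exp j := by
    have hbd : ∀ θ : Spin, ‖cosS (m • θ) * Real.exp (j * cosS θ)‖ ≤ Real.exp j := by
      intro θ
      rw [norm_mul, Real.norm_eq_abs, Real.norm_eq_abs, Real.abs_exp]
      have := abs_cosS_le_one (m • θ)
      have := hexp θ
      have := Real.exp_pos (j * cosS θ)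
      nlinarith
    have h := norm_integral_le_of_norm_le_const (μ := (unif : Measure Spin))
      (Eventually.of_forall hbd)
    rwa [probReal_univ, mul_one] at h
  set p := plusExp J E Λ zero m u
  -- `R` is the weight with the subtree and its connecting edge deleted; by Ginibre, deletion cannot
  -- raise the coefficient at `u` above `p`.
  have hp : |∫ ξ, R ξ * cosS (m • ξ u - m • zero) ∂(prior V)| ≤ p * ∫ ξ, R ξ ∂(prior V) := by
    have h1 := abs_cosExp_le_plusExp J hE₂ Λ (fun _ => zero) zero m u (m • zero)
    unfold cosExp extendedGibbs at h1
    rw [integral_tilted_eq_div, abs_div, abs_of_pos (integral_exp_interaction_pos J E₂ Λ _),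
      div_le_iff₀ (integral_exp_interaction_pos J E₂ Λ _)] at h1
    simp_rw [mul_comm (R _)]
    exact h1
  have hp0 : 0 ≤ p := plusExp_nonneg J E Λ zero m u
  -- With the parent spin fixed at `φ`, replacing the density at `v` by `1` costs at most `exp j *
  -- ε`, and what remains is an exact convolution.
  have hinner : ∀ φ : Spin, ∫ η, cosS (m • η v - m • zero) *
      (Real.exp (j * cosS (η v - φ)) * Q η) ∂(prior V) ≤
      (∫ η, Q η ∂(prior V)) * (cosS (m • φ - m • zero) * κ + Real.exp j * ε) := by
    intro φ
    have h1 := integral_subtree_le J C (fun _ => zero) v hv hE₁ hε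
      (g := fun θ => cosS (m • θ - m • zero) * Real.exp (j * cosS (θ - φ))) (by fun_prop)
      (M := Real.exp j) (by
        intro θ
        rw [abs_mul, Real.abs_exp]
        have := abs_cosS_le_one (m • θ - m • zero)
        have := hexp (θ - φ)
        have := Real.exp_pos (j * cosS (θ - φ))
        nlinarith)
    rw [integral_cosS_mul_kernel] at h1
    unfold extendedGibbs at h1
    rw [integral_tilted_eq_div, div_le_iff₀ (integral_exp_interaction_pos J E₁ _ _)] at h1
    rw [mul_comm (∫ η, Q η ∂(prior V))]
    simp_rw [← mul_assoc]
    exact h1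
  have hnum : ∫ ξ, cosS (m • ξ v - m • zero) *
      Real.exp (interaction J E (patch Λ ξ fun _ => zero)) ∂(prior V) ≤
      (∫ η, Q η ∂(prior V)) * (Real.exp j * (p + ε) * ∫ ξ, R ξ ∂(prior V)) := by
    have h2 : ∫ ξ, cosS (m • ξ v - m • zero) *
        Real.exp (interaction J E (patch Λ ξ fun _ => zero)) ∂(prior V) ≤
        ∫ ξ, R ξ * ((∫ η, Q η ∂(prior V)) * (cosS (m • ξ u - m • zero) * κ + Real.exp j * ε))
          ∂(prior V) := by
      refine integral_prior_patch_le S (by fun_prop) (by fun_prop) fun ξ => ?_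
      simp_rw [hW, patch_of_mem hvS]
      have h1 : ∫ η, cosS (m • η v - m • zero) *
          (R ξ * (Real.exp (j * cosS (η v - ξ u)) * Q η)) ∂(prior V) =
          R ξ * ∫ η, cosS (m • η v - m • zero) *
            (Real.exp (j * cosS (η v - ξ u)) * Q η) ∂(prior V) := by
        rw [← integral_const_mul]
        congr 1 with η
        ring
      rw [h1]
      exact mul_le_mul_of_nonneg_left (hinner (ξ u)) (Real.exp_pos _).le
    refine h2.trans ?_
    have h3 : ∀ ξ, R ξ * ((∫ η, Q η ∂(prior V)) *
        (cosS (m • ξ u - m • zero) * κ + Real.exp j * ε)) =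
        (∫ η, Q η ∂(prior V)) * (κ * (R ξ * cosS (m • ξ u - m • zero)) +
          Real.exp j * ε * R ξ) := by
      intro ξ; ring
    simp_rw [h3]
    rw [integral_const_mul, integral_add (integrable_of_continuous (by fun_prop))
      (integrable_of_continuous (by fun_prop)), integral_const_mul, integral_const_mul]
    refine mul_le_mul_of_nonneg_left ?_ hQ.le
    have h4 : κ * ∫ ξ, R ξ * cosS (m • ξ u - m • zero) ∂(prior V) ≤
        Real.exp j * (p * ∫ ξ, R ξ ∂(prior V)) := by
      refine (le_abs_self _).trans ?_
      rw [abs_mul]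
      exact mul_le_mul hκ hp (abs_nonneg _) (Real.exp_pos j).le
    linarith
  -- Bounding the edge weight below by `exp (-j)` here and above by `exp j` in the numerator gives
  -- the constant `exp (2 * j)`.
  have hden : (∫ η, Q η ∂(prior V)) * (Real.exp (-j) * ∫ ξ, R ξ ∂(prior V)) ≤
      ∫ ξ, Real.exp (interaction J E (patch Λ ξ fun _ => zero)) ∂(prior V) := by
    have h1 : (∫ η, Q η ∂(prior V)) * (Real.exp (-j) * ∫ ξ, R ξ ∂(prior V)) =
        ∫ ξ, R ξ * (Real.exp (-j) * ∫ η, Q η ∂(prior V)) ∂(prior V) := by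
      rw [integral_mul_const]
      ring
    rw [h1]
    refine le_integral_prior_patch S (by fun_prop) (by fun_prop) fun ξ => ?_
    simp_rw [hW]
    rw [← integral_const_mul, ← integral_const_mul]
    refine integral_mono (integrable_of_continuous (by fun_prop))
      (integrable_of_continuous (by fun_prop)) fun η => ?_
    exact mul_le_mul_of_nonneg_left (mul_le_mul_of_nonneg_right (hexp' _) (Real.exp_pos _).le)
      (Real.exp_pos _).le
  change cosExp J E Λ (fun _ => zero) m v (m • zero) ≤ _
  unfold cosExp extendedGibbs
  rw [integral_tilted_eq_div, div_le_iff₀ (integral_exp_interaction_pos J E Λ _)]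
  refine hnum.trans ?_
  have h5 : (∫ η, Q η ∂(prior V)) * (Real.exp j * (p + ε) * ∫ ξ, R ξ ∂(prior V)) =
      Real.exp (2 * j) * (p + ε) *
        ((∫ η, Q η ∂(prior V)) * (Real.exp (-j) * ∫ ξ, R ξ ∂(prior V))) := by
    have : Real.exp j = Real.exp (2 * j) * Real.exp (-j) := by
      rw [← Real.exp_add]; congr 1; ring
    rw [this]; ring
  rw [h5]
  exact mul_le_mul_of_nonneg_left hden (by positivity)

end Decoupling

/-! ### The specification as a Markov kernel, and bounds for Gibbs states -/

section Kernel

variable {V : Type*} {G : SimpleGraph V} {o : V}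

theorem comap_domRestrict_le (S : Set V) :
    MeasurableSpace.comap (S.domRestrict : (V → Spin) → S → Spin) inferInstance ≤
      MeasurableSpace.pi := by
  have : Measurable (S.domRestrict : (V → Spin) → S → Spin) := by fun_prop
  exact this.comap_le

variable [Countable V]

theorem measurable_gibbs {J : G.edgeSet → ℝ≥0} {Λ D : Set V} (hΛD : Disjoint Λ D)
    {E : Finset G.edgeSet} (hE : (E : Set G.edgeSet) = edges G Λ D) :
    Measurable fun δ : V → Spin => gibbs G J Λ D δ := by
  refine Measure.measurable_of_measurable_coe _ fun s hs => ?_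
  have hr : Measurable (Λ.domRestrict : (V → Spin) → Λ → Spin) := by fun_prop
  have h1 : Continuous fun z : (V → Spin) × (V → Spin) =>
      Real.exp (interaction J E (patch Λ z.2 z.1)) := by fun_prop
  have h2 : Measurable fun δ : V → Spin =>
      ∫ ξ, Real.exp (interaction J E (patch Λ ξ δ)) ∂(prior V) :=
    (h1.measurable.stronglyMeasurable.integral_prod_right (ν := prior V)).measurable
  have h3 : Measurable fun z : (V → Spin) × (V → Spin) =>
      ENNReal.ofReal (Real.exp (interaction J E (patch Λ z.2 z.1)) /
        ∫ ξ, Real.exp (interaction J E (patch Λ ξ z.1)) ∂(prior V)) :=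
    (h1.measurable.div (h2.comp measurable_fst)).ennreal_ofReal
  have h4 := h3.lintegral_prod_right' (ν := (prior V).restrict (Λ.domRestrict ⁻¹' s))
  convert h4 using 2 with δ
  rw [gibbs_eq_map hΛD hE, Measure.map_apply hr hs, tilted_apply' _ _ (hr hs)]

theorem isProbabilityMeasure_gibbs {J : G.edgeSet → ℝ≥0} {Λ D : Set V} (hΛD : Disjoint Λ D)
    {E : Finset G.edgeSet} (hE : (E : Set G.edgeSet) = edges G Λ D) (δ : V → Spin) :
    IsProbabilityMeasure (gibbs G J Λ D δ) := by
  rw [gibbs_eq_map hΛD hE]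
  have : IsProbabilityMeasure ((prior V).tilted fun ξ => interaction J E (patch Λ ξ δ)) :=
    isProbabilityMeasure_tilted (integrable_exp_interaction J E Λ δ)
  exact Measure.isProbabilityMeasure_map (by fun_prop)

theorem integral_gibbs {J : G.edgeSet → ℝ≥0} {Λ D : Set V} (hΛD : Disjoint Λ D)
    {E : Finset G.edgeSet} (hE : (E : Set G.edgeSet) = edges G Λ D) (δ : V → Spin)
    {g : (Λ → Spin) → ℝ} (hg : Continuous g) :
    ∫ η, g η ∂(gibbs G J Λ D δ) = ∫ ξ, g (Λ.domRestrict ξ) ∂(extendedGibbs J E Λ δ) := by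
  rw [gibbs_eq_map hΛD hE, integral_map (Measurable.aemeasurable (by fun_prop))
    hg.aestronglyMeasurable]
  rfl

/-- The specification of the model in the region inside a cutset, as a Markov kernel. -/
noncomputable def gibbsKernel (o : V) (J : G.edgeSet → ℝ≥0) (C : Finset V)
    {E : Finset G.edgeSet} (hE : (E : Set G.edgeSet) = edges G (inside G o C) C) :
    ProbabilityTheory.Kernel (V → Spin) (inside G o C → Spin) where
  toFun δ := gibbsCutset G o J C δ
  measurable' := measurable_gibbs (disjoint_inside C) hE

theorem gibbsKernel_apply (J : G.edgeSet → ℝ≥0) (C : Finset V)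
    {E : Finset G.edgeSet} (hE : (E : Set G.edgeSet) = edges G (inside G o C) C)
    (δ : V → Spin) : gibbsKernel o J C hE δ = gibbsCutset G o J C δ := rfl

instance (J : G.edgeSet → ℝ≥0) (C : Finset V)
    {E : Finset G.edgeSet} (hE : (E : Set G.edgeSet) = edges G (inside G o C) C) :
    ProbabilityTheory.IsMarkovKernel (gibbsKernel o J C hE) :=
  ⟨fun δ => isProbabilityMeasure_gibbs (disjoint_inside C) hE δ⟩

/-- Integrating the conditional-probability identity over the whole space removes the conditioning.
-/
theorem map_domRestrict_of_isGibbsState {J : G.edgeSet → ℝ≥0} {μ : Measure (V → Spin)}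
    (hμ : IsGibbsState G o J μ) {C : Finset V} (hC : IsCutset G o C)
    {E : Finset G.edgeSet} (hE : (E : Set G.edgeSet) = edges G (inside G o C) C) :
    μ.map (inside G o C).domRestrict = μ.bind (gibbsKernel o J C hE) := by
  have := hμ.1
  have hr : Measurable ((inside G o C).domRestrict : (V → Spin) → inside G o C → Spin) := by
    fun_prop
  ext A hA
  rw [Measure.map_apply hr hA, Measure.bind_apply hA (ProbabilityTheory.Kernel.aemeasurable _)]
  have h1 := integral_condExp (μ := μ) (f := ((inside G o C).domRestrict ⁻¹' A).indicator
    (fun _ => (1 : ℝ))) (comap_domRestrict_le (C ∪ outside G C : Set V))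
  rw [integral_congr_ae (hμ.2 C hC A hA), integral_indicator (hr hA), setIntegral_const,
    smul_eq_mul, mul_one] at h1
  have h2 : ∫ ξ, (gibbsCutset G o J C ξ).real A ∂μ =
      (∫⁻ ξ, gibbsKernel o J C hE ξ A ∂μ).toReal := by
    simp_rw [← gibbsKernel_apply J C hE, Measure.real]
    refine integral_toReal ?_ (Eventually.of_forall fun ξ => measure_lt_top _ _)
    exact (ProbabilityTheory.Kernel.measurable_coe _ hA).aemeasurable
  rw [h2, Measure.real] at h1
  refine ((ENNReal.toReal_eq_toReal_iff' (ne_of_lt ?_) (measure_ne_top _ _)).1 h1).symm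
  refine (lintegral_mono fun ξ => prob_le_one).trans_lt ?_
  simp

theorem integral_cosS_eq_of_isGibbsState {J : G.edgeSet → ℝ≥0} {μ : Measure (V → Spin)}
    (hμ : IsGibbsState G o J μ) {C : Finset V} (hC : IsCutset G o C)
    {E : Finset G.edgeSet} (hE : (E : Set G.edgeSet) = edges G (inside G o C) C)
    {v : V} (hv : v ∈ inside G o C) (m : ℤ) (c : Spin) :
    ∫ ξ, cosS (m • ξ v - c) ∂μ = ∫ ξ, cosExp J E (inside G o C) ξ m v c ∂μ := by
  have := hμ.1
  have hr : Measurable ((inside G o C).domRestrict : (V → Spin) → inside G o C → Spin) := by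
    fun_prop
  let g : (inside G o C → Spin) → ℝ := fun η => cosS (m • η ⟨v, hv⟩ - c)
  have hg : Continuous g := by fun_prop
  have h1 : ∫ ξ, cosS (m • ξ v - c) ∂μ = ∫ η, g η ∂(μ.map (inside G o C).domRestrict) := by
    rw [integral_map hr.aemeasurable hg.aestronglyMeasurable]
    rfl
  rw [h1, map_domRestrict_of_isGibbsState hμ hC hE, ← Measure.snd_compProd, Measure.snd,
    integral_map measurable_snd.aemeasurable hg.aestronglyMeasurable,
    Measure.integral_compProd (integrable_of_continuous (by fun_prop))]
  congr 1 with ξ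
  rw [gibbsKernel_apply, gibbsCutset, integral_gibbs (disjoint_inside C) hE ξ hg]
  rfl

/-- A Gibbs state has smaller Fourier coefficients than the plus state in any finite region. -/
theorem abs_integral_cosS_le_plusExp {J : G.edgeSet → ℝ≥0} {μ : Measure (V → Spin)}
    (hμ : IsGibbsState G o J μ) {C : Finset V} (hC : IsCutset G o C)
    {E : Finset G.edgeSet} (hE : (E : Set G.edgeSet) = edges G (inside G o C) C)
    {v : V} (hv : v ∈ inside G o C) (zero : Spin) (m : ℤ) (c : Spin) :
    |∫ ξ, cosS (m • ξ v - c) ∂μ| ≤ plusExp J E (inside G o C) zero m v := by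
  have := hμ.1
  rw [integral_cosS_eq_of_isGibbsState hμ hC hE hv]
  have h := norm_integral_le_of_norm_le_const (μ := μ)
    (f := fun ξ => cosExp J E (inside G o C) ξ m v c) (Eventually.of_forall fun ξ =>
      abs_cosExp_le_plusExp J (subset_refl E) (inside G o C) ξ zero m v c)
  rwa [probReal_univ, mul_one] at h

end Kernel

/-! ### SB implies SB+ -/

section SymmetryBreaking

variable {V : Type*} {G : SimpleGraph V} {o : V}

/-- Otherwise there is, for each `N`, a bad cutset whose inside contains the ball of radius `N`;
these approach infinity with norms at least `ε`, which is SB+. -/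
theorem eventually_density_of_not_sbPlus {J : G.edgeSet → ℝ≥0} {zero : Spin}
    (h : ¬ SBPlus G o J zero) (v : V) {ε : ℝ} (hε : 0 < ε) :
    ∃ N : ℕ, ∀ C, IsCutset G o C → (∀ w, G.dist o w ≤ N → w ∈ inside G o C) →
      ∀ hv : v ∈ inside G o C,
        ∀ᵐ θ ∂unif, |density G o J C (fun _ => zero) v hv θ - 1| ≤ ε := by
  by_contra! hno
  choose C hC hball hv hbad using hno
  refine h ⟨v, C, hv, ⟨hC, fun w => ?_⟩, ?_⟩
  · filter_upwards [eventually_ge_atTop (G.dist o w)] with n hn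
    exact hball n w hn
  · refine (lt_of_lt_of_le (ENNReal.ofReal_pos.2 hε) (le_iInf fun n => ?_)).ne'
    by_contra! hlt
    refine hbad n ?_
    have := ae_le_eLpNormEssSup (μ := unif)
      (f := fun θ => density G o J (C n) (fun _ => zero) v (hv n) θ - 1)
    filter_upwards [this] with θ hθ
    rw [eLpNorm_exponent_top] at hlt
    have h2 := hθ.trans hlt.le
    rw [Real.enorm_eq_ofReal_abs] at h2
    exact not_lt.2 ((ENNReal.ofReal_le_ofReal_iff hε.le).1 h2)

/-- Induction on the distance to the root, where the subtree is the whole tree and the density bound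
applies directly. -/
theorem eventually_plusExp_le [G.LocallyFinite] (hG : G.IsTree) {J : G.edgeSet → ℝ≥0}
    {zero : Spin} (h : ¬ SBPlus G o J zero) {m : ℤ} (hm : m ≠ 0) (v : V) {ε : ℝ} (hε : 0 < ε) :
    ∃ N : ℕ, ∀ C, IsCutset G o C → (∀ w, G.dist o w ≤ N → w ∈ inside G o C) →
      ∀ E : Finset G.edgeSet, (E : Set G.edgeSet) = edges G (inside G o C) C →
        plusExp J E (inside G o C) zero m v ≤ ε := by
  have : Countable V := countable_of_locallyFinite hG.connected o
  induction hd : G.dist o v generalizing v ε with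
  | zero =>
    obtain rfl : o = v := hG.connected.dist_eq_zero_iff.1 hd
    obtain ⟨N, hN⟩ := eventually_density_of_not_sbPlus h o hε
    refine ⟨N, fun C hC hball E hE => ?_⟩
    have hT : subtree G o o = Set.univ := by
      ext w; simp [subtree, Le]
    have h1 := integral_subtree_le J C (fun _ => zero) o (root_mem_inside hC) (E := E)
      (by rw [hE, hT, Set.inter_univ, Set.inter_univ])
      (hN C hC hball (root_mem_inside hC)) (g := fun θ => cosS (m • θ - m • zero))
      (by fun_prop) (M := 1) (fun θ => abs_cosS_le_one _)
    rw [integral_cosS_zsmul unif hm, zero_add, one_mul, hT, Set.inter_univ] at h1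
    exact h1
  | succ d ih =>
    have hov : o ≠ v := by rintro rfl; simp at hd
    obtain ⟨u, huv, hud⟩ := exists_adj_dist_add_one hG.connected hov
    set j : ℝ := (J ⟨s(u, v), huv⟩ : ℝ)
    -- Chosen so that `exp (2 * j) * (ε' + ε') = ε`: one share for the parent, one for the density
    -- at `v`.
    set ε' : ℝ := ε / (2 * Real.exp (2 * j))
    have hε' : 0 < ε' := by positivity
    obtain ⟨N₁, hN₁⟩ := ih u hε' (by omega)
    obtain ⟨N₂, hN₂⟩ := eventually_density_of_not_sbPlus h v hε'
    refine ⟨max (max N₁ N₂) (d + 1), fun C hC hball E hE => ?_⟩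
    have hu : u ∈ inside G o C := hball u (le_max_of_le_right (by omega))
    have hv : v ∈ inside G o C := hball v (le_max_of_le_right (by omega))
    have h1 := hN₁ C hC (fun w hw => hball w (le_max_of_le_left (le_max_of_le_left hw))) E hE
    have h2 := hN₂ C hC (fun w hw => hball w (le_max_of_le_left (le_max_of_le_right hw))) hv
    refine (plusExp_le_of_parent hG J C zero hu hv huv hud hE hε'.le h2 m).trans ?_
    calc Real.exp (2 * j) * (plusExp J E (inside G o C) zero m u + ε')
        ≤ Real.exp (2 * j) * (ε' + ε') := by gcongr
      _ = ε := by
        have := Real.exp_pos (2 * j)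
        simp only [ε']
        field_simp
        norm_num

theorem sbPlus_of_sb [G.LocallyFinite] (hG : G.IsTree) {J : G.edgeSet → ℝ≥0} (zero : Spin)
    (h : SB G o J) : SBPlus G o J zero := by
  by_contra hno
  have : Countable V := countable_of_locallyFinite hG.connected o
  obtain ⟨μ, hμ, v, hv⟩ := h
  have := hμ.1
  apply hv
  have : IsProbabilityMeasure (μ.map fun ξ => ξ v) :=
    Measure.isProbabilityMeasure_map (measurable_pi_apply v).aemeasurable
  rw [eq_unif_of_integral_cosS_eq_zero (μ.map fun ξ => ξ v)]
  · infer_instance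
  intro m hm c
  rw [integral_map (measurable_pi_apply v).aemeasurable
    (Continuous.aestronglyMeasurable (by fun_prop)), ← abs_nonpos_iff]
  refine le_of_forall_pos_le_add fun ε hε => ?_
  rw [zero_add]
  obtain ⟨N, hN⟩ := eventually_plusExp_le hG hno hm v hε
  obtain ⟨C, hC, hball⟩ := exists_isCutset hG o (max N (G.dist o v))
  obtain ⟨E, hE⟩ := (finite_edges (G := G) (finite_inside hG hC) (C : Set V)).exists_finset_coe
  exact (abs_integral_cosS_le_plusExp hμ hC hE (hball v (le_max_right _ _)) zero m c).trans
    (hN C hC (fun w hw => hball w (le_max_of_le_left hw)) E hE)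

end SymmetryBreaking

/-! ### Infinite-volume limits of plus states -/

section InfiniteVolume

variable {V : Type*} {G : SimpleGraph V} {o : V}

/-- The component of an inside vertex lies in the inside, so it cannot be infinite. -/
theorem disjoint_inside_outside {C : Finset V} (hfin : (inside G o C).Finite) :
    Disjoint (inside G o C) (C ∪ outside G C : Set V) := by
  refine Set.disjoint_union_right.2 ⟨disjoint_inside C, Set.disjoint_left.2 fun x hx hx' => ?_⟩
  refine hx' (hfin.subset ?_)
  obtain ⟨p, hp⟩ := hx
  rintro y ⟨q, hq⟩
  refine ⟨p.append q, fun z hz => ?_⟩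
  rcases (SimpleGraph.Walk.mem_support_append_iff _ _).1 hz with h | h
  · exact hp z h
  · exact hq z h

theorem extendedGibbs_congr (J : G.edgeSet → ℝ≥0) {E : Finset G.edgeSet} {Λ D : Set V}
    (hΛD : Disjoint Λ D) (hE : (E : Set G.edgeSet) = edges G Λ D) {δ δ' : V → Spin}
    (h : ∀ x ∈ D, δ x = δ' x) : extendedGibbs J E Λ δ = extendedGibbs J E Λ δ' := by
  unfold extendedGibbs
  congr 1 with ξ
  refine interaction_congr fun e he x hx => ?_
  rcases mem_or_mem_of_mem_edges (hE ▸ (Finset.mem_coe.2 he) : e ∈ edges G _ _) hx with hx | hx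
  · rw [patch_of_mem hx, patch_of_mem hx]
  · rw [patch_of_notMem (Set.disjoint_right.1 hΛD hx),
      patch_of_notMem (Set.disjoint_right.1 hΛD hx), h x hx]

/-- The Gibbs weight of a large region factorizes over the inside of a cutset. -/
theorem exists_factorization_inside (J : G.edgeSet → ℝ≥0) (zero : Spin) {C : Finset V}
    {F : Finset G.edgeSet} (hF : (F : Set G.edgeSet) = edges G (inside G o C) C)
    {Λ D : Set V} (hI : inside G o C ⊆ Λ) (hCΛ : (C : Set V) ⊆ Λ)
    {E : Finset G.edgeSet} (hE : (E : Set G.edgeSet) = edges G Λ D) :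
    ∃ E₂ ⊆ E, ∀ η ξ, interaction J E (patch Λ (patch (inside G o C) η ξ) fun _ => zero) =
      interaction J E₂ (patch Λ ξ fun _ => zero) +
        interaction J F (patch (inside G o C) η ξ) := by
  classical
  have hFE : F ⊆ E := by
    rw [← Finset.coe_subset, hF, hE]
    exact edges_mono hI fun x hx => Or.inl (hCΛ hx)
  refine ⟨E \ F, Finset.sdiff_subset, fun η ξ => ?_⟩
  rw [interaction_sdiff J hFE, add_comm]
  congr 1
  · refine interaction_congr fun e he x hx => ?_
    by_cases hxΛ : x ∈ Λ
    · rw [patch_of_mem hxΛ, patch_of_mem hxΛ]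
      refine patch_of_notMem (fun hxI => (Finset.mem_sdiff.1 he).2 ?_) _ _
      rw [← Finset.mem_coe, hF]
      refine mem_edges_of_forall hx hxI fun y _ hadj => ?_
      by_cases hy : y ∈ C
      · exact Or.inr hy
      · exact Or.inl (mem_component_of_adj hxI hadj hy)
    · rw [patch_of_notMem hxΛ, patch_of_notMem hxΛ]
  · refine interaction_congr fun e he x hx => patch_of_mem ?_ _ _
    rcases mem_or_mem_of_mem_edges (hF ▸ (Finset.mem_coe.2 he) : e ∈ edges G _ _) hx with h | h
    · exact hI h
    · exact hCΛ h

variable [Countable V]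

theorem continuous_integral_prior {X : Type*} [TopologicalSpace X] [FirstCountableTopology X]
    [LocallyCompactSpace X] {f : X → (V → Spin) → ℝ} (hf : Continuous (Function.uncurry f)) :
    Continuous fun x => ∫ ξ, f x ξ ∂(prior V) := by
  have := continuous_parametric_integral_of_continuous (μ := prior V) hf isCompact_univ
  simpa only [Measure.restrict_univ] using this

/-- Feller property: it lets the consistency relation pass to weak limits. -/
theorem continuous_integral_extendedGibbs (J : G.edgeSet → ℝ≥0) (E : Finset G.edgeSet)
    (Λ : Set V) {f : (V → Spin) → ℝ} (hf : Continuous f) :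
    Continuous fun δ => ∫ η, f η ∂(extendedGibbs J E Λ δ) := by
  unfold extendedGibbs
  simp_rw [integral_tilted_eq_div]
  refine (continuous_integral_prior ?_).div (continuous_integral_prior ?_)
    fun δ => (integral_exp_interaction_pos J E Λ δ).ne'
  · simp only [Function.uncurry_def]
    fun_prop
  · simp only [Function.uncurry_def]
    fun_prop

/-- Finite-volume Gibbs measures are consistent. -/
theorem integral_extendedGibbs_mul (J : G.edgeSet → ℝ≥0) (zero : Spin) {C : Finset V}
    {F : Finset G.edgeSet} (hF : (F : Set G.edgeSet) = edges G (inside G o C) C)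
    {Λ D : Set V} (hI : inside G o C ⊆ Λ) (hCΛ : (C : Set V) ⊆ Λ)
    {E : Finset G.edgeSet} (hE : (E : Set G.edgeSet) = edges G Λ D)
    {f g : (V → Spin) → ℝ} (hf : Continuous f) (hg : Continuous g)
    (hfI : ∀ η ξ, f (patch (inside G o C) η ξ) = f η)
    (hgI : ∀ η ξ, g (patch (inside G o C) η ξ) = g ξ) :
    ∫ ξ, f ξ * g ξ ∂(extendedGibbs J E Λ fun _ => zero) =
      ∫ ξ, (∫ η, f η ∂(extendedGibbs J F (inside G o C) ξ)) * g ξ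
        ∂(extendedGibbs J E Λ fun _ => zero) := by
  obtain ⟨E₂, -, hfac⟩ := exists_factorization_inside J zero hF hI hCΛ hE
  have hB := continuous_integral_extendedGibbs J F (inside G o C) hf
  set B : (V → Spin) → ℝ := fun ξ => ∫ η, f η ∂(extendedGibbs J F (inside G o C) ξ) with hBdef
  have hBI : ∀ η ξ, B (patch (inside G o C) η ξ) = B ξ := by
    intro η ξ
    simp only [hBdef]
    rw [extendedGibbs_congr J (disjoint_inside C) hF fun x hx =>
      patch_of_notMem (Set.disjoint_right.1 (disjoint_inside C) hx) η ξ]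
  have key : ∀ a : (V → Spin) → ℝ, ∫ ξ, a ξ ∂(extendedGibbs J E Λ fun _ => zero) =
      (∫ ξ, a ξ * Real.exp (interaction J E (patch Λ ξ fun _ => zero)) ∂(prior V)) /
        ∫ ξ, Real.exp (interaction J E (patch Λ ξ fun _ => zero)) ∂(prior V) :=
    fun a => integral_tilted_eq_div _ _ _
  change _ = ∫ ξ, B ξ * g ξ ∂(extendedGibbs J E Λ fun _ => zero)
  -- Integrate over the inside spins first: `g`, `B` and the weight of the edges outside `F` are
  -- then constant.
  rw [key, key, integral_prior_patch (inside G o C) (by fun_prop),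
    integral_prior_patch (inside G o C) (F := fun ξ => B ξ * g ξ *
      Real.exp (interaction J E (patch Λ ξ fun _ => zero))) (by fun_prop)]
  congr 2 with ξ
  simp_rw [hfac, hfI, hgI, hBI, Real.exp_add]
  have h1 : ∀ a : (V → Spin) → ℝ, ∫ η, a η * g ξ *
      (Real.exp (interaction J E₂ (patch Λ ξ fun _ => zero)) *
        Real.exp (interaction J F (patch (inside G o C) η ξ))) ∂(prior V) =
      g ξ * Real.exp (interaction J E₂ (patch Λ ξ fun _ => zero)) *
        ∫ η, a η * Real.exp (interaction J F (patch (inside G o C) η ξ)) ∂(prior V) := by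
    intro a
    rw [← integral_const_mul]
    congr 1 with η
    ring
  rw [h1 f, h1 fun _ => B ξ, integral_const_mul]
  congr 1
  simp only [hBdef, extendedGibbs]
  rw [integral_tilted_eq_div, div_mul_cancel₀ _ (integral_exp_interaction_pos J F (inside G o C) ξ).ne']

/-- A measure satisfying the consistency relation for continuous functions is a Gibbs state. -/
theorem isGibbsState_of_forall_continuous [G.LocallyFinite] (hG : G.IsTree)
    (J : G.edgeSet → ℝ≥0) (μ : Measure (V → Spin)) [IsProbabilityMeasure μ]
    (h : ∀ C, IsCutset G o C → ∀ F : Finset G.edgeSet,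
      (F : Set G.edgeSet) = edges G (inside G o C) C →
      ∀ f g : (V → Spin) → ℝ, Continuous f → Continuous g →
      (∀ η ξ, f (patch (inside G o C) η ξ) = f η) →
      (∀ η ξ, g (patch (inside G o C) η ξ) = g ξ) →
      ∫ ξ, f ξ * g ξ ∂μ = ∫ ξ, (∫ η, f η ∂(extendedGibbs J F (inside G o C) ξ)) * g ξ ∂μ) :
    IsGibbsState G o J μ := by
  refine ⟨inferInstance, fun C hC => ?_⟩
  obtain ⟨F, hF⟩ := (finite_edges (G := G) (finite_inside hG hC) (C : Set V)).exists_finset_coe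
  set I := inside G o C
  set S : Set V := C ∪ outside G C
  intro A hA
  have hIS : Disjoint I S := disjoint_inside_outside (finite_inside hG hC)
  have hrI : Measurable (I.domRestrict : (V → Spin) → I → Spin) := by fun_prop
  have hrS : Measurable (S.domRestrict : (V → Spin) → S → Spin) := by fun_prop
  let κ := gibbsKernel o J C hF
  -- The joint law of the two restrictions is determined by products of continuous test functions,
  -- which is all that `h` provides.
  have hν : μ.map (fun ξ => (I.domRestrict ξ, S.domRestrict ξ)) =
      (μ.compProd κ).map (fun z => (z.2, S.domRestrict z.1)) := by
    refine Measure.ext_of_integral_mul_boundedContinuousFunction fun f g => ?_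
    have hf := f.continuous
    have hg := g.continuous
    have hcI : Continuous (I.domRestrict : (V → Spin) → I → Spin) := by fun_prop
    have hcS : Continuous (S.domRestrict : (V → Spin) → S → Spin) := by fun_prop
    rw [integral_map (by fun_prop) (Continuous.aestronglyMeasurable (by fun_prop)),
      integral_map (by fun_prop) (Continuous.aestronglyMeasurable (by fun_prop)),
      Measure.integral_compProd (integrable_of_continuous (by fun_prop))]
    have := h C hC F hF (fun ξ => f (I.domRestrict ξ)) (fun ξ => g (S.domRestrict ξ))
      (hf.comp hcI) (hg.comp hcS) (fun η ξ => by rw [domRestrict_patch])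
      (fun η ξ => by rw [domRestrict_patch_of_disjoint hIS])
    refine this.trans ?_
    congr 1 with ξ
    change _ = ∫ η, f η * g (S.domRestrict ξ) ∂(κ ξ)
    rw [integral_mul_const]
    congr 1
    exact (integral_gibbs (disjoint_inside C) hF ξ hf).symm
  have hκ : ∀ ξ, (gibbsCutset G o J C ξ).real A = (κ ξ).real A := fun ξ => rfl
  -- The kernel only reads the spins on `C ⊆ S`, so those off `S` may be reset to `0`.
  have hmeas : Measurable[MeasurableSpace.comap S.domRestrict inferInstance]
      fun ξ : V → Spin => (κ ξ).real A := by
    have h1 : (fun ξ : V → Spin => (κ ξ).real A) =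
        (fun σ : S → Spin => (κ (glue S σ 0)).real A) ∘ S.domRestrict := by
      ext ξ
      simp only [Function.comp_apply]
      congr 1
      change gibbs G J I C ξ = gibbs G J I C (patch S ξ 0)
      rw [gibbs_eq_map (disjoint_inside C) hF, gibbs_eq_map (disjoint_inside C) hF]
      congr 1
      exact extendedGibbs_congr J (disjoint_inside C) hF fun x hx =>
        (patch_of_mem (Set.mem_union_left _ hx : x ∈ S) ξ 0).symm
    rw [h1]
    refine Measurable.comp ?_ (comap_measurable _)
    have h2 : Measurable fun σ : S → Spin => glue S σ (0 : V → Spin) := by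
      refine measurable_pi_lambda _ fun v => ?_
      unfold glue
      by_cases hv : v ∈ S
      · simp only [hv, dite_true]; fun_prop
      · simp only [hv, dite_false]; fun_prop
    exact ((ProbabilityTheory.Kernel.measurable_coe κ hA).comp h2).ennreal_toReal
  have hle := comap_domRestrict_le (V := V) S
  have hint : Integrable (fun ξ : V → Spin => (κ ξ).real A) μ := by
    refine Integrable.of_bound (C := 1) (hmeas.mono hle le_rfl).aestronglyMeasurable
      (Eventually.of_forall fun ξ => ?_)
    rw [Real.norm_eq_abs, abs_of_nonneg measureReal_nonneg]
    exact measureReal_le_one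
  simp_rw [hκ]
  refine (ae_eq_condExp_of_forall_setIntegral_eq hle ((integrable_const _).indicator (hrI hA))
    (fun s _ _ => hint.integrableOn) ?_ hmeas.stronglyMeasurable.aestronglyMeasurable).symm
  rintro s ⟨B, hB, rfl⟩ -
  have h3 := congrArg (fun ν => ν (A ×ˢ B)) hν
  rw [Measure.map_apply (by fun_prop) (hA.prod hB),
    Measure.map_apply (by fun_prop) (hA.prod hB)] at h3
  have h4 : (fun z : (V → Spin) × (I → Spin) => (z.2, S.domRestrict z.1)) ⁻¹' (A ×ˢ B) =
      (S.domRestrict ⁻¹' B) ×ˢ A := by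
    ext z
    simp only [Set.mem_preimage, Set.mem_prod, and_comm]
  have h5 : (fun ξ : V → Spin => (I.domRestrict ξ, S.domRestrict ξ)) ⁻¹' (A ×ˢ B) =
      (I.domRestrict ⁻¹' A) ∩ (S.domRestrict ⁻¹' B) := rfl
  rw [h4, h5, Measure.compProd_apply_prod (hrS hB) hA] at h3
  rw [setIntegral_indicator (hrI hA), setIntegral_const, smul_eq_mul, mul_one, Set.inter_comm,
    Measure.real, h3]
  exact integral_toReal (ProbabilityTheory.Kernel.measurable_coe κ hA).aemeasurable
    (Eventually.of_forall fun ξ => measure_lt_top _ _)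

/-- Subsequential limits of the plus states in finite regions are Gibbs states. -/
theorem exists_isGibbsState_tendsto [G.LocallyFinite] (hG : G.IsTree) (J : G.edgeSet → ℝ≥0)
    (zero : Spin) {C : ℕ → Finset V} (hC : ApproachesInfinity G o C)
    (E : ℕ → Finset G.edgeSet)
    (hE : ∀ n, (E n : Set G.edgeSet) = edges G (inside G o (C n)) (C n)) :
    ∃ μ : Measure (V → Spin), IsGibbsState G o J μ ∧ ∀ f : (V → Spin) → ℝ, Continuous f →
      Tendsto (fun n => ∫ ξ, f ξ ∂(extendedGibbs J (E n) (inside G o (C n)) fun _ => zero))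
        (hyperfilter ℕ : Filter ℕ) (nhds (∫ ξ, f ξ ∂μ)) := by
  let μs : ℕ → ProbabilityMeasure (V → Spin) := fun n =>
    ⟨extendedGibbs J (E n) (inside G o (C n)) fun _ => zero, inferInstance⟩
  -- Probability measures on a compact space form a compact space; an ultrafilter replaces the
  -- choice of a subsequence.
  obtain ⟨μ, -, hμ⟩ := isCompact_univ.ultrafilter_le_nhds' ((hyperfilter ℕ).map μs) univ_mem
  have hlim : ∀ f : (V → Spin) → ℝ, Continuous f →
      Tendsto (fun n => ∫ ξ, f ξ ∂(extendedGibbs J (E n) (inside G o (C n)) fun _ => zero))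
        (hyperfilter ℕ : Filter ℕ) (nhds (∫ ξ, f ξ ∂(μ : Measure (V → Spin)))) := fun f hf =>
    ProbabilityMeasure.tendsto_iff_forall_integral_tendsto.1
      (show Tendsto μs (hyperfilter ℕ) (nhds μ) from hμ) (BoundedContinuousFunction.mkOfCompact
        ⟨f, hf⟩)
  refine ⟨μ, ?_, hlim⟩
  refine isGibbsState_of_forall_continuous hG J _ fun C' hC' F hF f g hf hg hfI hgI => ?_
  -- Once `C n` encloses the finite set `inside G o C' ∪ C'`, finite-volume consistency holds
  -- exactly.
  have hev : ∀ᶠ n in (hyperfilter ℕ : Filter ℕ), ∀ x ∈ inside G o C' ∪ C', x ∈ inside G o (C n) :=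
    Nat.hyperfilter_le_atTop ((eventually_all_finite
      ((finite_inside hG hC').union C'.finite_toSet)).2 fun x _ => hC.2 x)
  refine tendsto_nhds_unique_of_eventuallyEq (hlim _ (hf.mul hg))
    (hlim _ ((continuous_integral_extendedGibbs J F (inside G o C') hf).mul hg)) ?_
  filter_upwards [hev] with n hn
  exact integral_extendedGibbs_mul J zero hF (fun x hx => hn x (Or.inl hx))
    (fun x hx => hn x (Or.inr hx)) (hE n) hf hg hfI hgI

end InfiniteVolume

/-- Along an ultrafilter, uniformly log-Lipschitz densities converging weakly to the uniform
measure converge uniformly. -/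
theorem eventually_abs_sub_one_le {ι : Type*} (U : Ultrafilter ι) (d : ι → Spin → ℝ) {L : ℝ}
    (hL : 0 ≤ L) (hd : ∀ i, Continuous (d i)) (hd₀ : ∀ i θ, 0 ≤ d i θ)
    (hlip : ∀ i θ θ', d i θ' ≤ Real.exp (L * ‖θ' - θ‖) * d i θ)
    (hweak : ∀ F : C(Spin, ℝ), Tendsto (fun i => ∫ θ, d i θ * F θ ∂unif) U
      (nhds (∫ θ, F θ ∂unif))) {c : ℝ} (hc : 0 < c) :
    ∀ᶠ i in (U : Filter ι), ∀ θ, |d i θ - 1| ≤ c := by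
  by_contra hno
  rw [← Ultrafilter.eventually_not] at hno
  push Not at hno
  -- A point of large deviation for each `i`, with `0` as default; these points converge along `U`
  -- by compactness.
  obtain ⟨t, ht⟩ : ∃ t : ι → Spin, ∀ i, (∃ θ, c < |d i θ - 1|) → c < |d i (t i) - 1| := by
    choose t ht using fun i => show ∃ θ, (∃ θ, c < |d i θ - 1|) → c < |d i θ - 1| by
      by_cases h : ∃ θ, c < |d i θ - 1|
      · exact ⟨h.choose, fun _ => h.choose_spec⟩
      · exact ⟨0, fun h' => absurd h' h⟩
    exact ⟨t, ht⟩
  obtain ⟨θ₀, -, hθ₀⟩ := isCompact_univ.ultrafilter_le_nhds' (U.map t) univ_mem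
  have hθ₀' : Tendsto t U (nhds θ₀) := hθ₀
  -- Two points of the ball of radius `r` are within `2 * r`, so each density varies there by a
  -- factor below `1 + c`. The tent function `F` tests that ball.
  obtain ⟨r, hr, hexp⟩ : ∃ r : ℝ, 0 < r ∧ Real.exp (L * (2 * r)) < 1 + c := by
    have h1 : Tendsto (fun r : ℝ => Real.exp (L * (2 * r))) (nhdsWithin 0 (Set.Ioi 0))
        (nhds 1) := by
      have : Continuous fun r : ℝ => Real.exp (L * (2 * r)) := by fun_prop
      have h := this.tendsto 0
      simp only [mul_zero, Real.exp_zero] at h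
      exact h.mono_left nhdsWithin_le_nhds
    obtain ⟨r, h2, h3⟩ := ((h1.eventually (gt_mem_nhds (by linarith : (1 : ℝ) < 1 + c))).and
      self_mem_nhdsWithin).exists
    exact ⟨r, h3, h2⟩
  set q := Real.exp (L * (2 * r))
  have hq : 0 < q := Real.exp_pos _
  let F : C(Spin, ℝ) := ⟨fun θ => max 0 (r - ‖θ - θ₀‖), by fun_prop⟩
  have hF₀ : ∀ θ, 0 ≤ F θ := fun θ => le_max_left _ _
  have hFint : Integrable F unif := integrable_of_continuous F.continuous
  have hFd : ∀ i, Integrable (fun θ => d i θ * F θ) unif := fun i =>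
    integrable_of_continuous ((hd i).mul F.continuous)
  have hFpos : 0 < ∫ θ, F θ ∂unif := by
    refine F.continuous.integral_pos_of_hasCompactSupport_nonneg_nonzero
      (HasCompactSupport.of_compactSpace _) hF₀ (x := θ₀) ?_
    change max 0 (r - ‖θ₀ - θ₀‖) ≠ 0
    rw [sub_self, norm_zero, sub_zero, max_eq_right hr.le]
    exact hr.ne'
  have hnear : ∀ᶠ i in (U : Filter ι), ‖t i - θ₀‖ < r := by
    filter_upwards [Metric.tendsto_nhds.1 hθ₀' r hr] with i hi
    rwa [dist_eq_norm] at hi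
  have hclose : ∀ i, ‖t i - θ₀‖ < r → ∀ θ, F θ = 0 ∨
      (d i (t i) ≤ q * d i θ ∧ d i θ ≤ q * d i (t i)) := by
    intro i hi θ
    by_cases hθ : ‖θ - θ₀‖ < r
    · right
      have h1 : ‖t i - θ‖ ≤ 2 * r := by
        have : t i - θ = (t i - θ₀) - (θ - θ₀) := by abel
        rw [this]
        refine (norm_sub_le _ _).trans ?_
        linarith
      have h2 : Real.exp (L * ‖t i - θ‖) ≤ q :=
        Real.exp_le_exp.2 (mul_le_mul_of_nonneg_left h1 hL)
      refine ⟨(hlip i θ (t i)).trans (mul_le_mul_of_nonneg_right h2 (hd₀ _ _)),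
        (hlip i (t i) θ).trans ?_⟩
      rw [norm_sub_rev]
      exact mul_le_mul_of_nonneg_right h2 (hd₀ _ _)
    · left
      exact max_eq_left (by linarith)
  have hsplit : ∀ᶠ i in (U : Filter ι), 1 + c < d i (t i) ∨ d i (t i) < 1 - c := by
    filter_upwards [hno] with i hi
    rcases lt_abs.1 (ht i hi) with h | h
    · left; linarith
    · right; linarith
  rcases Ultrafilter.eventually_or.1 hsplit with h | h
  · have hge : (1 + c) * ∫ θ, F θ ∂unif ≤ q * ∫ θ, F θ ∂unif := by
      refine ge_of_tendsto ((hweak F).const_mul q) ?_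
      filter_upwards [h, hnear] with i hi hi'
      rw [← integral_const_mul, ← integral_const_mul]
      refine integral_mono (hFint.const_mul _) ((hFd i).const_mul _) fun θ => ?_
      rcases hclose i hi' θ with h0 | ⟨h1, -⟩
      · simp [h0]
      · simp only [← mul_assoc]
        exact mul_le_mul_of_nonneg_right (hi.le.trans h1) (hF₀ θ)
    exact absurd (le_of_mul_le_mul_right hge hFpos) (not_le.2 hexp)
  · have hle : 1 * ∫ θ, F θ ∂unif ≤ (q * (1 - c)) * ∫ θ, F θ ∂unif := by
      rw [one_mul]
      refine le_of_tendsto (hweak F) ?_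
      filter_upwards [h, hnear] with i hi hi'
      rw [← integral_const_mul]
      refine integral_mono (hFd i) (hFint.const_mul _) fun θ => ?_
      rcases hclose i hi' θ with h0 | ⟨-, h1⟩
      · simp [h0]
      · exact mul_le_mul_of_nonneg_right
          (h1.trans (mul_le_mul_of_nonneg_left hi.le hq.le)) (hF₀ θ)
    have h1 := le_of_mul_le_mul_right hle hFpos
    -- The contradiction is `1 ≤ q * (1 - c) < (1 + c) * (1 - c) ≤ 1`, which needs this sign.
    have h2 : 0 < 1 - c := by
      by_contra h3
      nlinarith
    nlinarith

/-! ### Regularity of one-vertex densities -/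

section Density

variable {V : Type*} {G : SimpleGraph V} {o : V}

theorem abs_pairEnergy_sub_le (ξ ξ' : V → Spin) {v : V} (h : ∀ x, x ≠ v → ξ' x = ξ x)
    {e : Sym2 V} (hd : ¬ e.IsDiag) :
    |pairEnergy ξ e - pairEnergy ξ' e| ≤ ‖ξ' v - ξ v‖ := by
  obtain ⟨⟨x, y⟩, rfl⟩ := exists_pair e
  have hxy : x ≠ y := hd
  simp only [pairEnergy_mk]
  rw [neg_sub_neg]
  refine (abs_cosS_sub_le _ _).trans ?_
  by_cases hx : x = v
  · subst hx
    rw [h y hxy.symm]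
    refine le_of_eq ?_
    congr 1
    abel
  · rw [h x hx]
    by_cases hy : y = v
    · subst hy
      rw [norm_sub_rev (ξ' y)]
      refine le_of_eq ?_
      congr 1
      abel
    · rw [h y hy, sub_self, norm_zero]
      exact norm_nonneg _

open Classical in
/-- Changing the spin at `v` changes the interaction by a bounded multiple of the change. -/
theorem interaction_le_add (J : G.edgeSet → ℝ≥0) (E I : Finset G.edgeSet) (ξ ξ' : V → Spin)
    {v : V} (hI : ∀ e : G.edgeSet, v ∈ (e : Sym2 V) → e ∈ I) (h : ∀ x, x ≠ v → ξ' x = ξ x) :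
    interaction J E ξ' ≤ interaction J E ξ + (∑ e ∈ I, (J e : ℝ)) * ‖ξ' v - ξ v‖ := by
  have h1 : ∑ e ∈ E, (J e : ℝ) * (pairEnergy ξ e - pairEnergy ξ' e) ≤
      ∑ e ∈ E, (if e ∈ I then (J e : ℝ) else 0) * ‖ξ' v - ξ v‖ := by
    refine Finset.sum_le_sum fun e _ => ?_
    split_ifs with he
    · refine mul_le_mul_of_nonneg_left ?_ (NNReal.coe_nonneg _)
      exact (le_abs_self _).trans
        (abs_pairEnergy_sub_le ξ ξ' h (G.not_isDiag_of_mem_edgeSet e.2))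
    · have hv : v ∉ (e : Sym2 V) := fun hv => he (hI e hv)
      have h2 : pairEnergy ξ e = pairEnergy ξ' e := by
        obtain ⟨⟨x, y⟩, hxy⟩ := exists_pair (e : Sym2 V)
        rw [hxy] at hv ⊢
        rw [Sym2.mem_iff, not_or] at hv
        rw [pairEnergy_mk, pairEnergy_mk, h x (Ne.symm hv.1), h y (Ne.symm hv.2)]
      rw [h2, sub_self, mul_zero, zero_mul]
  rw [← Finset.sum_mul] at h1
  have h2 : ∑ e ∈ E, (if e ∈ I then (J e : ℝ) else 0) ≤ ∑ e ∈ I, (J e : ℝ) := by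
    rw [← Finset.sum_filter]
    exact Finset.sum_le_sum_of_subset_of_nonneg
      (fun e he => (Finset.mem_filter.1 he).2) fun e _ _ => NNReal.coe_nonneg _
  have h3 := mul_le_mul_of_nonneg_right h2 (norm_nonneg (ξ' v - ξ v))
  have h4 : interaction J E ξ' - interaction J E ξ =
      ∑ e ∈ E, (J e : ℝ) * (pairEnergy ξ e - pairEnergy ξ' e) := by
    unfold interaction
    simp_rw [mul_sub, Finset.sum_sub_distrib]
    ring
  linarith

/-- The continuous version of the density of the spin at `v`. -/
noncomputable def spinDensity (J : G.edgeSet → ℝ≥0) (E : Finset G.edgeSet) (Λ : Set V)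
    (δ : V → Spin) (v : V) (θ : Spin) : ℝ :=
  (∫ ξ, Real.exp (interaction J E (patch Λ (patch {v} (fun _ => θ) ξ) δ)) ∂(prior V)) /
    ∫ ξ, Real.exp (interaction J E (patch Λ ξ δ)) ∂(prior V)

variable [Countable V]

theorem continuous_spinDensity (J : G.edgeSet → ℝ≥0) (E : Finset G.edgeSet) (Λ : Set V)
    (δ : V → Spin) (v : V) : Continuous (spinDensity J E Λ δ v) := by
  unfold spinDensity
  refine Continuous.div_const (continuous_integral_prior ?_) _
  simp only [Function.uncurry_def]
  fun_prop

theorem spinDensity_nonneg (J : G.edgeSet → ℝ≥0) (E : Finset G.edgeSet) (Λ : Set V)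
    (δ : V → Spin) (v : V) (θ : Spin) : 0 ≤ spinDensity J E Λ δ v θ :=
  div_nonneg (integral_nonneg fun _ => (Real.exp_pos _).le)
    (integral_exp_interaction_pos J E Λ δ).le

/-- The constant involves only the couplings of `I`, which can be taken to be the edges at `v`;
hence it is uniform in the cutset. -/
theorem spinDensity_le (J : G.edgeSet → ℝ≥0) (E I : Finset G.edgeSet) (Λ : Set V)
    (δ : V → Spin) {v : V} (hv : v ∈ Λ) (hI : ∀ e : G.edgeSet, v ∈ (e : Sym2 V) → e ∈ I)
    (θ θ' : Spin) : spinDensity J E Λ δ v θ' ≤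
      Real.exp ((∑ e ∈ I, (J e : ℝ)) * ‖θ' - θ‖) * spinDensity J E Λ δ v θ := by
  unfold spinDensity
  rw [← mul_div_assoc]
  refine div_le_div_of_nonneg_right ?_ (integral_exp_interaction_pos J E Λ δ).le
  rw [← integral_const_mul]
  refine integral_mono (integrable_of_continuous (by fun_prop))
    (integrable_of_continuous (by fun_prop)) fun ξ => ?_
  simp only
  rw [← Real.exp_add]
  refine Real.exp_le_exp.2 ?_
  rw [add_comm]
  have h := interaction_le_add J E I (patch Λ (patch {v} (fun _ => θ) ξ) δ)
    (patch Λ (patch {v} (fun _ => θ') ξ) δ) (v := v) hI (by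
      intro x hx
      have hx' : x ∉ ({v} : Set V) := hx
      by_cases hxΛ : x ∈ Λ
      · rw [patch_of_mem hxΛ, patch_of_mem hxΛ, patch_of_notMem hx', patch_of_notMem hx']
      · rw [patch_of_notMem hxΛ, patch_of_notMem hxΛ])
  rw [patch_of_mem hv, patch_of_mem hv, patch_of_mem (Set.mem_singleton v),
    patch_of_mem (Set.mem_singleton v)] at h
  exact h

/-- Resampling the spin at `v` separates it from the others under the product measure, after which
Fubini applies. -/
theorem integral_eval_eq_spinDensity (J : G.edgeSet → ℝ≥0) (E : Finset G.edgeSet) (Λ : Set V)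
    (δ : V → Spin) (v : V) {g : Spin → ℝ} (hg : Continuous g) :
    ∫ ξ, g (ξ v) ∂(extendedGibbs J E Λ δ) = ∫ θ, spinDensity J E Λ δ v θ * g θ ∂unif := by
  unfold extendedGibbs
  rw [integral_tilted_eq_div]
  have h1 : ∀ η ξ : V → Spin, patch {v} η ξ = patch {v} (fun _ => η v) ξ := by
    intro η ξ
    ext x
    by_cases hx : x ∈ ({v} : Set V)
    · rw [patch_of_mem hx, patch_of_mem hx, Set.mem_singleton_iff.1 hx]
    · rw [patch_of_notMem hx, patch_of_notMem hx]
  have hF : Continuous fun ξ : V → Spin =>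
      g (ξ v) * Real.exp (interaction J E (patch Λ ξ δ)) := by fun_prop
  have h2 : ∫ ξ, g (ξ v) * Real.exp (interaction J E (patch Λ ξ δ)) ∂(prior V) =
      ∫ η, g (η v) * (∫ ξ, Real.exp (interaction J E (patch Λ (patch {v} (fun _ => η v) ξ) δ))
        ∂(prior V)) ∂(prior V) := by
    rw [← (measurePreserving_patch {v}).map_eq,
      integral_map (measurable_patch _).aemeasurable hF.aestronglyMeasurable,
      (measurePreserving_patch {v}).map_eq,
      integral_prod _ (integrable_of_continuous (by fun_prop))]
    congr 1 with η
    rw [← integral_const_mul]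
    congr 1 with ξ
    rw [h1, patch_of_mem (Set.mem_singleton v)]
  let Φ : Spin → ℝ := fun θ =>
    g θ * ∫ ξ, Real.exp (interaction J E (patch Λ (patch {v} (fun _ => θ) ξ) δ)) ∂(prior V)
  have hΦ : Continuous Φ := by
    refine hg.mul (continuous_integral_prior ?_)
    simp only [Function.uncurry_def]
    fun_prop
  have h3 : ∫ η : V → Spin, Φ (η v) ∂(prior V) = ∫ θ, Φ θ ∂unif := by
    rw [← Measure.infinitePi_map_eval (fun _ : V => unif) v,
      integral_map (measurable_pi_apply v).aemeasurable hΦ.aestronglyMeasurable]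
  rw [h2, h3, ← integral_div]
  congr 1 with θ
  simp only [Φ, spinDensity]
  ring

theorem density_ae_eq (J : G.edgeSet → ℝ≥0) (C : Finset V) (δ : V → Spin) (v : V)
    (hv : v ∈ inside G o C) {E : Finset G.edgeSet}
    (hE : (E : Set G.edgeSet) = edges G (inside G o C ∩ subtree G o v) (C ∩ subtree G o v)) :
    density G o J C δ v hv =ᵐ[unif] spinDensity J E (inside G o C ∩ subtree G o v) δ v := by
  set S := inside G o C ∩ subtree G o v
  have hc := continuous_spinDensity J E S δ v
  have hprob : IsProbabilityMeasure ((extendedGibbs J E S δ).map fun ξ => ξ v) :=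
    Measure.isProbabilityMeasure_map (measurable_pi_apply v).aemeasurable
  have hfin : IsFiniteMeasure (unif.withDensity fun θ =>
      ENNReal.ofReal (spinDensity J E S δ v θ)) :=
    isFiniteMeasure_withDensity_ofReal (integrable_of_continuous hc).2
  have hmap : (extendedGibbs J E S δ).map (fun ξ => ξ v) =
      unif.withDensity fun θ => ENNReal.ofReal (spinDensity J E S δ v θ) := by
    refine ext_of_forall_integral_eq_of_IsFiniteMeasure fun g => ?_
    rw [integral_map (measurable_pi_apply v).aemeasurable g.continuous.aestronglyMeasurable,
      integral_eval_eq_spinDensity J E S δ v g.continuous,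
      integral_withDensity_eq_integral_toReal_smul hc.measurable.ennreal_ofReal
        (Eventually.of_forall fun θ => ENNReal.ofReal_lt_top)]
    congr 1 with θ
    rw [ENNReal.toReal_ofReal (spinDensity_nonneg J E S δ v θ), smul_eq_mul]
  have hrn := Measure.rnDeriv_withDensity unif hc.measurable.ennreal_ofReal
  filter_upwards [hrn] with θ hθ
  rw [density_eq J C δ v hv hE, hmap, hθ, ENNReal.toReal_ofReal (spinDensity_nonneg J E S δ v θ)]

end Density

/-! ### SB+ implies SB -/

section SymmetryBreaking

variable {V : Type*} {G : SimpleGraph V} {o : V}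

theorem sb_of_sbPlus [G.LocallyFinite] (hG : G.IsTree) {J : G.edgeSet → ℝ≥0} {zero : Spin}
    (h : SBPlus G o J zero) : SB G o J := by
  have : Countable V := countable_of_locallyFinite hG.connected o
  obtain ⟨v, C, hv, hC, hinf⟩ := h
  let S : ℕ → Set V := fun n => inside G o (C n) ∩ subtree G o v
  choose E hE using fun n => (finite_edges (G := G) (finite_inside hG (hC.1 n))
    (C n : Set V)).exists_finset_coe
  choose E₁ hE₁ using fun n => (finite_edges (G := G)
    ((finite_inside hG (hC.1 n)).subset Set.inter_subset_left : (S n).Finite)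
    (C n ∩ subtree G o v : Set V)).exists_finset_coe
  obtain ⟨I, hI⟩ := (finite_edges (G := G) (Set.finite_singleton v) Set.univ).exists_finset_coe
  have hI' : ∀ e : G.edgeSet, v ∈ (e : Sym2 V) → e ∈ I := by
    intro e he
    rw [← Finset.mem_coe, hI]
    exact mem_edges_of_forall he rfl fun y _ _ => Or.inr trivial
  obtain ⟨μ, hμ, hlim⟩ := exists_isGibbsState_tendsto hG J zero hC E hE
  refine ⟨μ, hμ, v, fun hinv => hinf ?_⟩
  have hplus : ∀ m : ℤ, m ≠ 0 → Tendsto (fun n => plusExp J (E n) (inside G o (C n)) zero m v)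
      (hyperfilter ℕ : Filter ℕ) (nhds 0) := by
    intro m hm
    have h1 := hlim (fun ξ => cosS (m • ξ v - m • zero)) (by fun_prop)
    have h2 := integral_cosS_zsmul (μ.map fun ξ => ξ v) hm (m • zero)
    rw [integral_map (measurable_pi_apply v).aemeasurable
      (Continuous.aestronglyMeasurable (by fun_prop))] at h2
    rw [h2] at h1
    exact h1
  let ν : ℕ → Measure Spin := fun n =>
    (extendedGibbs J (E₁ n) (S n) fun _ => zero).map fun ξ => ξ v
  have hν : ∀ n, IsProbabilityMeasure (ν n) := fun n =>
    Measure.isProbabilityMeasure_map (measurable_pi_apply v).aemeasurable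
  have hνint : ∀ n (g : Spin → ℝ), Continuous g →
      ∫ θ, g θ ∂(ν n) = ∫ ξ, g (ξ v) ∂(extendedGibbs J (E₁ n) (S n) fun _ => zero) :=
    fun n g hg => integral_map (measurable_pi_apply v).aemeasurable hg.aestronglyMeasurable
  -- The subtree system is the full system with edges deleted, so Ginibre bounds its coefficients by
  -- the plus coefficients at `v`.
  have hcoef : ∀ m : ℤ, m ≠ 0 → ∀ c, Tendsto (fun n => ∫ θ, cosS (m • θ - c) ∂(ν n))
      (hyperfilter ℕ : Filter ℕ) (nhds 0) := by
    intro m hm c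
    refine squeeze_zero_norm (fun n => ?_) (hplus m hm)
    have hsub : E₁ n ⊆ E n := by
      rw [← Finset.coe_subset, hE₁, hE]
      exact edges_subtree_subset (C n) v
    refine le_trans (le_of_eq ?_) (abs_cosExp_le_plusExp J hsub (inside G o (C n))
      (fun _ => zero) zero m v c)
    rw [Real.norm_eq_abs, hνint n _ (by fun_prop)]
    unfold cosExp extendedGibbs
    simp_rw [interaction_subtree J (C n) v (hE₁ n)]
    rfl
  have hweak := tendsto_integral_of_tendsto_cosS ν hcoef
  have hvS : ∀ n, v ∈ S n := fun n => ⟨hv n, mem_subtree_self G o v⟩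
  have hunif : ∀ c : ℝ, 0 < c → ∀ᶠ n in (hyperfilter ℕ : Filter ℕ), ∀ θ,
      |spinDensity J (E₁ n) (S n) (fun _ => zero) v θ - 1| ≤ c := by
    intro c hc
    refine eventually_abs_sub_one_le (hyperfilter ℕ)
      (fun n => spinDensity J (E₁ n) (S n) (fun _ => zero) v) (L := ∑ e ∈ I, (J e : ℝ))
      (Finset.sum_nonneg fun e _ => NNReal.coe_nonneg _)
      (fun n => continuous_spinDensity J (E₁ n) (S n) _ v)
      (fun n θ => spinDensity_nonneg J (E₁ n) (S n) _ v θ)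
      (fun n θ θ' => spinDensity_le J (E₁ n) I (S n) _ (hvS n) hI' θ θ') (fun F => ?_) hc
    refine (hweak F).congr fun n => ?_
    rw [hνint n F F.continuous, integral_eval_eq_spinDensity J (E₁ n) (S n) _ v F.continuous]
  by_contra hne
  -- Uniform convergence yields a single `n` with norm at most `c`, below the supposed infimum.
  obtain ⟨c, hc, hclt⟩ := ENNReal.lt_iff_exists_nnreal_btwn.1 (pos_iff_ne_zero.2 hne)
  obtain ⟨n, hn⟩ := (hunif c (by exact_mod_cast hc)).exists
  refine absurd (hclt.trans_le (iInf_le _ n)) (not_lt.2 ?_)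
  rw [eLpNorm_exponent_top]
  refine eLpNormEssSup_le_of_ae_bound (C := (c : ℝ)) ?_ |>.trans_eq (by simp)
  filter_upwards [density_ae_eq J (C n) (fun _ => zero) v (hv n) (hE₁ n)] with θ hθ
  rw [hθ]
  exact hn θ

end SymmetryBreaking

end Rotor

/-- For the rotor model on a tree with a bounded number of children per vertex and arbitrary
nonnegative interaction strengths, symmetry breaking is equivalent to symmetry breaking with plus
boundary conditions, whichever point of the circle is chosen as the plus state. -/
theorem proposition1p2 {V : Type*} (G : SimpleGraph V) [G.LocallyFinite] (hG : G.IsTree) (o : V)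
    (B : ℕ) (hB : ∀ v : V, (Rotor.children G o v).ncard ≤ B)
    (J : G.edgeSet → ℝ≥0) (zero : Rotor.Spin) :
    Rotor.SB G o J ↔ Rotor.SBPlus G o J zero :=
  ⟨Rotor.sbPlus_of_sb hG zero, Rotor.sb_of_sbPlus hG⟩
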